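/- Let $d\ge 1$, let $\Omega\subset\mathbb R^d$ be a bounded, connected, open set, and let $F:\mathbb R^d\to[0,+\infty]$ be lower semicontinuous, strictly convex (on its effective domain) and superlinear, i.e. $F(\xi)/|\xi|\to+\infty$ as $|\xi|\to\infty$, with $F(0)=0$. For $u\in L^1(\Omega)$ put $\Phi(u)=\int_\Omega F(\nabla u)\,dx$ if $u\in W^{1,1}(\Omega)$ and $\Phi(u)=+\infty$ otherwise. Let $u^0\in L^1(\Omega)$ with $\Phi(u^0)<+\infty$, and impose Dirichlet conditions: "$v=u^0$ on $\partial\Omega$" means $v-u^0\in W^{1,1}_0(\Omega)$, the closure of $C_c^\infty(\Omega)$ in $W^{1,1}(\Omega)$. Assume that $u^0$ is a subsolution: $\Phi(v)\ge\Phi(u^0)$ for every $v\le u^0$ with $v=u^0$ on $\partial\Omega$. For $\tau>0$, a minimizing movement is a sequence $(u^n)_{n\ge0}$ starting at $u^0$ such that, for every $n\ge 1$, $u^n$ minimizes $\Phi(v)+\frac1{2\tau}\|v-u^{n-1}\|_{L^1(\Omega)}^2$ among all $v$ with $v=u^0$ on $\partial\Omega$; put $u_\tau(t)=u^{\lfloor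 t/\tau\rfloor}$. A limit solution with initial datum $u^0$ is a function $u\in C([0,+\infty);L^1(\Omega))$ for which there are $\tau_k\to0$, $\tau_k>0$, and corresponding minimizing movements with $u_{\tau_k}\to u$ in $L^\infty([0,T];L^1(\Omega))$ for every $T>0$. Then there exists exactly one limit solution $u$ with initial datum $u^0$. It satisfies $\|u(s)-u(t)\|_{L^1(\Omega)}\le\sqrt{2\Phi(u^0)}\sqrt{|t-s|}$ for all $s,t\ge0$, and it is non-decreasing in $t$ (if $s\le t$ then $u(s)\le u(t)$ a.e. in $\Omega$). Moreover, there is a non-increasing function $\lambda:(0,+\infty)\to[0,+\infty)$ with $\lambda\in L^2((0,+\infty))$ such that, for a.e. $t>0$, $u(t)=v^{\lambda(t)}$, where $v^{\lambda}$ denotes the unique solution of the obstacle problem $$\min\Big\{\Phi(v)+\lambda\int_\Omega v\,dx\ :\ v\ge u^0 \text{ a.e. in }\Omega,\ v=u^0\text{ on }\partial\Omega\Big\}.$$ Finally, $\lambda(t)>0$ for every $t>0$ such that $u(t)$ does not minimize $\Phi$ among all $v$ with $v=u^0$ on $\partial\Omega$. -/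

import Mathlib

open MeasureTheory Filter Topology Set
open scoped NNReal ENNReal ContDiff Gradient

noncomputable section

/-- The Euclidean space of dimension `d`. -/
abbrev E (d : ℕ) : Type := EuclideanSpace ℝ (Fin d)

/-- The Banach lattice `L¹(Ω)` (Lebesgue measure, real-valued functions modulo a.e. equality). -/
abbrev L1 {d : ℕ} (Ω : Set (E d)) : Type := Lp ℝ 1 ((volume : Measure (E d)).restrict Ω)

/-- Strict convexity of an extended-valued function (on its effective domain; when `F p` or `F q`
is infinite the convexity inequality is automatic). -/
def StrictlyConvex {d : ℕ} (F : E d → ℝ≥0∞) : Prop :=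
  ∀ p q : E d, p ≠ q → F p ≠ ⊤ → F q ≠ ⊤ →
    ∀ a b : ℝ≥0, 0 < a → 0 < b → a + b = 1 →
      F (a • p + b • q) < (a : ℝ≥0∞) * F p + (b : ℝ≥0∞) * F q

/-- Superlinear growth: `F p / |p| → ∞` as `|p| → ∞`. -/
def Superlinear {d : ℕ} (F : E d → ℝ≥0∞) : Prop :=
  Tendsto (fun p : E d => F p / ‖p‖ₑ) (Bornology.cobounded (E d)) (𝓝 ⊤)

/-- `φ ∈ C_c^∞(Ω)`. -/
structure IsTestFunction {d : ℕ} (Ω : Set (E d)) (φ : E d → ℝ) : Prop where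
  smooth : ContDiff ℝ ∞ φ
  compact : HasCompactSupport φ
  support : tsupport φ ⊆ Ω

/-- `u ∈ W^{1,1}(Ω)` with weak gradient `G`: `G` is integrable on `Ω` and
`∫_Ω u ∇φ = - ∫_Ω φ G` for every test function `φ`. -/
def IsWeakGradient {d : ℕ} (Ω : Set (E d)) (u : L1 Ω) (G : E d → E d) : Prop :=
  IntegrableOn G Ω ∧
    ∀ φ : E d → ℝ, IsTestFunction Ω φ →
      ∫ x in Ω, u x • ∇ φ x = - ∫ x in Ω, φ x • G x

/-- `W^{1,1}_0(Ω)`: the closure of `C_c^∞(Ω)` in `W^{1,1}(Ω)`. -/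
def W11Zero {d : ℕ} (Ω : Set (E d)) : Set (L1 Ω) :=
  {w | ∃ G : E d → E d, IsWeakGradient Ω w G ∧
    ∀ ε : ℝ≥0∞, 0 < ε → ∃ φ : E d → ℝ, IsTestFunction Ω φ ∧
      (∫⁻ x in Ω, ‖φ x - w x‖ₑ) + (∫⁻ x in Ω, ‖∇ φ x - G x‖ₑ) < ε}

/-- `Φ(u) = ∫_Ω F(Du)` if `u ∈ W^{1,1}(Ω)`, and `+∞` otherwise, for a superlinear `F`.
The weak gradient is unique up to null sets, so the infimum is over at most one value;
over the empty set it is `⊤`. -/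
def energy {d : ℕ} (F : E d → ℝ≥0∞) (Ω : Set (E d)) (u : L1 Ω) : ℝ≥0∞ :=
  ⨅ (G : E d → E d) (_ : IsWeakGradient Ω u G), ∫⁻ x in Ω, F (G x)

/-- The functional with Dirichlet conditions: `Φ(u)` if `u = u0` on `∂Ω`,
that is `u ∈ u0 + W^{1,1}_0(Ω)`, and `+∞` otherwise. -/
def dirichletEnergy {d : ℕ} (F : E d → ℝ≥0∞) (Ω : Set (E d)) (u0 u : L1 Ω) : ℝ≥0∞ :=
  ⨅ (_ : u - u0 ∈ W11Zero Ω), energy F Ω u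

/-- `u0` is a subsolution: lowering `u0`, while keeping its boundary values, does not
decrease `Φ`. -/
def IsSubsolution {d : ℕ} (F : E d → ℝ≥0∞) (Ω : Set (E d)) (u0 : L1 Ω) : Prop :=
  ∀ v : L1 Ω, v - u0 ∈ W11Zero Ω → v ≤ u0 → energy F Ω u0 ≤ energy F Ω v

/-- `u` minimizes `Φ(u) + ‖u - w‖₁² / (2τ)` over `L¹(Ω)`, with Dirichlet datum `u0`. -/
def IsMinimizingStep {d : ℕ} (F : E d → ℝ≥0∞) (Ω : Set (E d)) (u0 : L1 Ω) (τ : ℝ)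
    (w u : L1 Ω) : Prop :=
  ∀ v : L1 Ω,
    dirichletEnergy F Ω u0 u + ENNReal.ofReal (‖u - w‖ ^ 2 / (2 * τ)) ≤
      dirichletEnergy F Ω u0 v + ENNReal.ofReal (‖v - w‖ ^ 2 / (2 * τ))

/-- `U 0 = u0, U 1, U 2, …` is a minimizing movement with time step `τ`. -/
def IsMinimizingMovement {d : ℕ} (F : E d → ℝ≥0∞) (Ω : Set (E d)) (u0 : L1 Ω) (τ : ℝ)
    (U : ℕ → L1 Ω) : Prop :=
  U 0 = u0 ∧ ∀ n : ℕ, IsMinimizingStep F Ω u0 τ (U n) (U (n + 1))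

/-- `u ∈ C([0,∞); L¹(Ω))` is a limit solution with initial datum `u0`: along some sequence of time
steps `τ_k → 0`, the piecewise constant interpolants `t ↦ u^{⌊t/τ_k⌋}` of minimizing movements
converge to `u` in `L¹(Ω)`, uniformly on every `[0,T]`. -/
def IsLimitSolution {d : ℕ} (F : E d → ℝ≥0∞) (Ω : Set (E d)) (u0 : L1 Ω)
    (u : ℝ≥0 → L1 Ω) : Prop :=
  Continuous u ∧
    ∃ (τ : ℕ → ℝ) (U : ℕ → ℕ → L1 Ω),
      (∀ k, 0 < τ k) ∧ Tendsto τ atTop (𝓝 0) ∧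
      (∀ k, IsMinimizingMovement F Ω u0 (τ k) (U k)) ∧
      ∀ T : ℝ≥0, TendstoUniformlyOn (fun (k : ℕ) (t : ℝ≥0) => U k ⌊(t : ℝ) / τ k⌋₊) u atTop
        (Icc 0 T)

/-- `v` solves the obstacle problem: it minimizes `Φ(v) + l ∫_Ω v` among all `v ≥ u0` with
`v = u0` on `∂Ω`. -/
def IsObstacleSolution {d : ℕ} (F : E d → ℝ≥0∞) (Ω : Set (E d)) (u0 : L1 Ω) (l : ℝ)
    (v : L1 Ω) : Prop :=
  u0 ≤ v ∧
    IsMinOn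
      (fun v' : L1 Ω =>
        (dirichletEnergy F Ω u0 v' : EReal) + ((l * ∫ x in Ω, v' x : ℝ) : EReal))
      {v' | u0 ≤ v'} v

end

/-! The evolution is one-dimensional in disguise. The gradients of `u ⊔ v` and `u ⊓ v` are those of
`u` and `v`, exchanged where `u ≤ v`, so the Dirichlet energy is submodular. Truncation then shows
that an implicit step from a subsolution goes up and ends at a subsolution (`IsImplicitStep.le`,
`IsImplicitStep.isEnergySub`). Between ordered functions the `L¹` distance is a difference of
integrals ("masses"), so the first-order condition says that the new state minimizes `Φ + l ∫` above
the old one, with `l` the mass gained divided by `τ` (`IsImplicitStep.solvesObstacle`). These speeds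
decrease along a movement, and submodularity allows the old state to be replaced by `u0` as obstacle
(`SolvesObstacle.trans`).

Hence every state after the initial one, of every movement with any time step, solves an obstacle
problem above `u0`. Such solutions are totally ordered, and a strictly larger mass forces a
multiplier that is no larger. So `L¹` distances are mass differences, and the masses follow an
implicit Euler scheme for a scalar inclusion `m' ∈ λ(m)` with `λ` non-increasing. A comparison of
two schemes (`EulerScheme.le_interp_add`) bounds the distance of movements with steps `τ`, `σ` by a
multiple of `√τ + √σ` (`IsMovement.norm_sub_le`). All movements therefore converge to a single
limit, which gives existence and uniqueness together.

The Hölder bound comes from the dissipation estimate `∑ τ l² ≤ 2 Φ(u0)` and Cauchy–Schwarz. Obstacle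
solutions are stable under limits (`SolvesObstacle.of_tendsto`), so `u t` is one for every `t > 0`;
`λ(t)` is its smallest nonnegative multiplier, and Fatou's lemma puts it in `L²`.

The analytic input is isolated in `IsLatticeEnergy`. Closedness of the sublevels and solvability of
the step use no weak compactness: from decreasing convex sets of vector fields of bounded
superlinear energy, near-minimizers of `∫ √(1 + |G|²)` form a strong Cauchy sequence
(`exists_cauchySeq_selection`). -/

/-! ### Calculus of test functions and Poincaré's inequality. -/

namespace IsTestFunction

variable {d : ℕ} {Ω : Set (E d)} {φ ψ : E d → ℝ}

lemma differentiable (hφ : IsTestFunction Ω φ) : Differentiable ℝ φ :=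
  hφ.smooth.differentiable (by simp)

lemma fderiv_apply (φ : E d → ℝ) (x v : E d) : fderiv ℝ φ x v = inner ℝ (∇ φ x) v := by
  simp [gradient]

lemma continuous_gradient (hφ : IsTestFunction Ω φ) : Continuous (∇ φ) :=
  (InnerProductSpace.toDual ℝ (E d)).symm.continuous.comp
    (hφ.smooth.continuous_fderiv (by simp))

lemma support_gradient_subset (φ : E d → ℝ) : Function.support (∇ φ) ⊆ tsupport φ := by
  intro x hx
  apply support_fderiv_subset ℝ (f := φ)
  intro h
  apply hx
  simp [gradient, h]

lemma hasCompactSupport_gradient (hφ : IsTestFunction Ω φ) : HasCompactSupport (∇ φ) :=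
  hφ.compact.mono' (support_gradient_subset φ)

lemma integrable (hφ : IsTestFunction Ω φ) : Integrable φ :=
  hφ.smooth.continuous.integrable_of_hasCompactSupport hφ.compact

lemma integrable_gradient (hφ : IsTestFunction Ω φ) : Integrable (∇ φ) :=
  hφ.continuous_gradient.integrable_of_hasCompactSupport hφ.hasCompactSupport_gradient

lemma eq_zero (hφ : IsTestFunction Ω φ) {x : E d} (hx : x ∉ Ω) : φ x = 0 :=
  image_eq_zero_of_notMem_tsupport fun h => hx (hφ.support h)

lemma gradient_eq_zero (hφ : IsTestFunction Ω φ) {x : E d} (hx : x ∉ Ω) : ∇ φ x = 0 := by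
  by_contra h
  exact hx (hφ.support (support_gradient_subset φ h))

lemma zero : IsTestFunction Ω (0 : E d → ℝ) where
  smooth := contDiff_const
  compact := HasCompactSupport.zero
  support := by simp [tsupport]

lemma add (hφ : IsTestFunction Ω φ) (hψ : IsTestFunction Ω ψ) : IsTestFunction Ω (φ + ψ) where
  smooth := hφ.smooth.add hψ.smooth
  compact := hφ.compact.add hψ.compact
  support := (tsupport_add φ ψ).trans (union_subset hφ.support hψ.support)

lemma gradient_add (hφ : IsTestFunction Ω φ) (hψ : IsTestFunction Ω ψ) :
    ∇ (φ + ψ) = ∇ φ + ∇ ψ := by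
  ext1 x
  simp [gradient, fderiv_add (hφ.differentiable x) (hψ.differentiable x)]

lemma comp (hφ : IsTestFunction Ω φ) {β : ℝ → ℝ} (hβ : ContDiff ℝ ∞ β) (h0 : β 0 = 0) :
    IsTestFunction Ω (β ∘ φ) where
  smooth := hβ.comp hφ.smooth
  compact := hφ.compact.comp_left h0
  support := (tsupport_comp_subset h0 φ).trans hφ.support

lemma gradient_comp (hφ : IsTestFunction Ω φ) {β : ℝ → ℝ} (hβ : ContDiff ℝ ∞ β) (x : E d) :
    ∇ (β ∘ φ) x = deriv β (φ x) • ∇ φ x := by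
  have h : HasFDerivAt (β ∘ φ) (deriv β (φ x) • fderiv ℝ φ x) x :=
    HasDerivAt.comp_hasFDerivAt x ((hβ.differentiable (by simp) (φ x)).hasDerivAt)
      (hφ.differentiable x).hasFDerivAt
  simp [gradient, h.fderiv]

lemma smul (c : ℝ) (hφ : IsTestFunction Ω φ) : IsTestFunction Ω (c • φ) :=
  hφ.comp (β := fun s => c * s) (by fun_prop) (by simp)

lemma gradient_smul (c : ℝ) (hφ : IsTestFunction Ω φ) : ∇ (c • φ) = c • ∇ φ := by
  ext1 x
  simp [gradient, fderiv_const_smul (hφ.differentiable x)]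

/-- Integration by parts for two test functions. -/
lemma integral_smul_gradient (hφ : IsTestFunction Ω φ) (hψ : IsTestFunction Ω ψ) :
    ∫ x in Ω, ψ x • ∇ φ x = - ∫ x in Ω, φ x • ∇ ψ x := by
  have cφ := hφ.smooth.continuous
  have cψ := hψ.smooth.continuous
  have i1 : Integrable (fun x => ψ x • ∇ φ x) :=
    (cψ.smul hφ.continuous_gradient).integrable_of_hasCompactSupport
      (hφ.hasCompactSupport_gradient.smul_left (f := ψ))
  have i2 : Integrable (fun x => φ x • ∇ ψ x) :=
    (cφ.smul hψ.continuous_gradient).integrable_of_hasCompactSupport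
      (hψ.hasCompactSupport_gradient.smul_left (f := φ))
  rw [setIntegral_eq_integral_of_forall_compl_eq_zero
      (fun x hx => by rw [hψ.eq_zero hx, zero_smul]),
    setIntegral_eq_integral_of_forall_compl_eq_zero
      (fun x hx => by rw [hφ.eq_zero hx, zero_smul])]
  apply ext_inner_left ℝ
  intro v
  rw [inner_neg_right, ← integral_inner i1, ← integral_inner i2]
  have key := integral_mul_fderiv_eq_neg_fderiv_mul_of_integrable (μ := (volume : Measure (E d)))
    (f := ψ) (g := φ) (v := v) ?_ ?_ ?_ (fun x _ => hψ.differentiable x)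
    (fun x _ => hφ.differentiable x)
  · have e1 : ∀ x, inner ℝ v (ψ x • ∇ φ x) = ψ x * fderiv ℝ φ x v := fun x => by
      rw [fderiv_apply, inner_smul_right, real_inner_comm]
    have e2 : ∀ x, inner ℝ v (φ x • ∇ ψ x) = fderiv ℝ ψ x v * φ x := fun x => by
      rw [fderiv_apply, inner_smul_right, real_inner_comm, mul_comm]
    simp only [e1, e2, key]
  · refine (i2.inner_const v).congr (ae_of_all _ fun x => ?_)
    simp only [fderiv_apply, inner_smul_left, RCLike.conj_to_real, mul_comm]
  · refine (i1.inner_const v).congr (ae_of_all _ fun x => ?_)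
    simp only [fderiv_apply, inner_smul_left, RCLike.conj_to_real]
  · exact (cψ.mul cφ).integrable_of_hasCompactSupport hφ.compact.mul_left

/-- The fundamental theorem of calculus on the segment from `x` to `x + v`, at whose far end `φ`
vanishes. -/
lemma enorm_le_lintegral_translate (hφ : IsTestFunction Ω φ) {v : E d}
    (hv : ∀ x ∈ Ω, x + v ∉ Ω) (x : E d) (hx : x ∈ Ω) :
    ‖φ x‖ₑ ≤ ∫⁻ s in Ioc (0 : ℝ) 1, ‖∇ φ (x + s • v)‖ₑ * ‖v‖ₑ := by
  have hd : ∀ s : ℝ, HasDerivAt (fun s : ℝ => φ (x + s • v)) (inner ℝ (∇ φ (x + s • v)) v) s := by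
    intro s
    rw [← fderiv_apply]
    have h1 : HasDerivAt (fun s : ℝ => x + s • v) v s := by
      simpa using ((hasDerivAt_id s).smul_const v).const_add x
    exact (hφ.differentiable (x + s • v)).hasFDerivAt.comp_hasDerivAt s h1
  have hc : Continuous fun s : ℝ => inner ℝ (∇ φ (x + s • v)) v :=
    (hφ.continuous_gradient.comp (by fun_prop)).inner continuous_const
  have h := intervalIntegral.integral_eq_sub_of_hasDerivAt (a := 0) (b := 1) (fun s _ => hd s)
    (hc.intervalIntegrable 0 1)
  rw [one_smul, hφ.eq_zero (hv x hx), zero_smul, add_zero, zero_sub] at h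
  rw [← enorm_neg, ← h, intervalIntegral.integral_of_le zero_le_one]
  refine (enorm_integral_le_lintegral_enorm _).trans (lintegral_mono fun s => ?_)
  rw [← ofReal_norm, ← ofReal_norm, ← ofReal_norm,
    ← ENNReal.ofReal_mul (norm_nonneg _)]
  exact ENNReal.ofReal_le_ofReal (norm_inner_le_norm _ _)

/-- Poincaré's inequality for test functions. -/
lemma lintegral_enorm_le (hφ : IsTestFunction Ω φ) {v : E d} (hv : ∀ x ∈ Ω, x + v ∉ Ω) :
    ∫⁻ x in Ω, ‖φ x‖ₑ ≤ ‖v‖ₑ * ∫⁻ x in Ω, ‖∇ φ x‖ₑ := by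
  have hc : Continuous fun p : E d × ℝ => ‖∇ φ (p.1 + p.2 • v)‖ₑ * ‖v‖ₑ := by
    have : Continuous fun p : E d × ℝ => ‖∇ φ (p.1 + p.2 • v)‖ₑ :=
      (hφ.continuous_gradient.comp (by fun_prop)).enorm
    exact ENNReal.continuous_mul_const (by simp) |>.comp this
  have hle : ∀ x, ‖φ x‖ₑ ≤ ∫⁻ s in Ioc (0 : ℝ) 1, ‖∇ φ (x + s • v)‖ₑ * ‖v‖ₑ := by
    intro x
    by_cases hx : x ∈ Ω
    · exact hφ.enorm_le_lintegral_translate hv x hx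
    · simp [hφ.eq_zero hx]
  calc ∫⁻ x in Ω, ‖φ x‖ₑ ≤ ∫⁻ x, ‖φ x‖ₑ := setLIntegral_le_lintegral _ _
    _ ≤ ∫⁻ x, ∫⁻ s in Ioc (0 : ℝ) 1, ‖∇ φ (x + s • v)‖ₑ * ‖v‖ₑ := lintegral_mono hle
    -- After Tonelli the inner integral does not depend on `s`, by translation invariance.
    _ = ∫⁻ s in Ioc (0 : ℝ) 1, ∫⁻ x, ‖∇ φ (x + s • v)‖ₑ * ‖v‖ₑ :=
        lintegral_lintegral_swap (f := fun (x : E d) (s : ℝ) => ‖∇ φ (x + s • v)‖ₑ * ‖v‖ₑ)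
          hc.measurable.aemeasurable
    _ = ∫⁻ s in Ioc (0 : ℝ) 1, ∫⁻ x, ‖∇ φ x‖ₑ * ‖v‖ₑ := by
        congr 1
        ext s
        exact lintegral_add_right_eq_self (fun x => ‖∇ φ x‖ₑ * ‖v‖ₑ) (s • v)
    _ = ‖v‖ₑ * ∫⁻ x, ‖∇ φ x‖ₑ := by
        rw [lintegral_const, lintegral_mul_const' _ _ (by simp)]
        simp [mul_comm]
    _ = ‖v‖ₑ * ∫⁻ x in Ω, ‖∇ φ x‖ₑ := by
        rw [setLIntegral_eq_of_support_subset]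
        intro x hx
        by_contra h
        exact hx (by simp [hφ.gradient_eq_zero h])

end IsTestFunction

lemma exists_translate_disjoint {d : ℕ} (hd : 0 < d) {Ω : Set (E d)}
    (hΩ : Bornology.IsBounded Ω) : ∃ v : E d, ∀ x ∈ Ω, x + v ∉ Ω := by
  have : Nonempty (Fin d) := ⟨⟨0, hd⟩⟩
  obtain ⟨C, hC⟩ := hΩ.exists_norm_le
  obtain ⟨v, hv⟩ := NormedSpace.exists_lt_norm ℝ (E d) (2 * C)
  refine ⟨v, fun x hx hxv => ?_⟩
  have h1 := hC x hx
  have h2 := hC _ hxv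
  have h3 : ‖v‖ ≤ ‖x + v‖ + ‖x‖ := by
    simpa using norm_sub_le (x + v) x
  linarith

/-! ### Continuity and distances in `L¹`. -/

section LpAux

variable {α F G : Type*} {mα : MeasurableSpace α} {μ : Measure α}
  [NormedAddCommGroup F] [NormedAddCommGroup G] [NormedSpace ℝ G]

lemma lipschitzWith_integral_comp_lp {T : α → F → G} {M : ℝ≥0}
    (hT : ∀ x a b, ‖T x a - T x b‖ ≤ M * ‖a - b‖)
    (hi : ∀ f : Lp F 1 μ, Integrable (fun x => T x (f x)) μ) :
    LipschitzWith M fun f : Lp F 1 μ => ∫ x, T x (f x) ∂μ := by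
  refine LipschitzWith.of_dist_le_mul fun f g => ?_
  rw [dist_eq_norm, dist_eq_norm, ← integral_sub (hi f) (hi g), L1.norm_eq_integral_norm,
    ← integral_const_mul]
  refine (norm_integral_le_integral_norm _).trans (integral_mono_ae ?_ ?_ ?_)
  · exact ((hi f).sub (hi g)).norm
  · exact (L1.integrable_coeFn (f - g)).norm.const_mul _
  · filter_upwards [Lp.coeFn_sub f g] with x hx
    rw [hx]
    exact hT x _ _

lemma L1.edist_eq_of_ae_eq {f : Lp F 1 μ} {g : Lp F 1 μ} {h : α → F} (hg : g =ᵐ[μ] h) :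
    edist f g = ∫⁻ x, ‖h x - f x‖ₑ ∂μ := by
  rw [L1.edist_def]
  refine lintegral_congr_ae ?_
  filter_upwards [hg] with x hx
  rw [hx, edist_comm, edist_eq_enorm_sub]

end LpAux

/-! ### `W^{1,1}_0` as a closed subspace of pairs (function, gradient). -/

section ZeroGraph

variable {d : ℕ} {Ω : Set (E d)}

/-- The Banach space of integrable vector fields on `Ω`. -/
abbrev L1Field (Ω : Set (E d)) : Type := Lp (E d) 1 ((volume : Measure (E d)).restrict Ω)

/-- The pairs `(φ, ∇φ)`, for test functions `φ`. -/
noncomputable def testPairs (Ω : Set (E d)) : Submodule ℝ (L1 Ω × L1Field Ω) where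
  carrier := {p | ∃ φ, IsTestFunction Ω φ ∧ p.1 =ᵐ[volume.restrict Ω] φ ∧
    p.2 =ᵐ[volume.restrict Ω] ∇ φ}
  zero_mem' := by
    refine ⟨0, IsTestFunction.zero, Lp.coeFn_zero _ _ _, ?_⟩
    refine (Lp.coeFn_zero _ _ _).trans (ae_of_all _ fun x => ?_)
    simp [gradient]
  add_mem' := by
    rintro p q ⟨φ, hφ, h1, h2⟩ ⟨ψ, hψ, h3, h4⟩
    refine ⟨φ + ψ, hφ.add hψ, (Lp.coeFn_add _ _).trans (h1.add h3), ?_⟩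
    rw [hφ.gradient_add hψ]
    exact (Lp.coeFn_add _ _).trans (h2.add h4)
  smul_mem' := by
    rintro c p ⟨φ, hφ, h1, h2⟩
    refine ⟨c • φ, hφ.smul c, (Lp.coeFn_smul _ _).trans (h1.const_smul c), ?_⟩
    rw [hφ.gradient_smul c]
    exact (Lp.coeFn_smul _ _).trans (h2.const_smul c)

/-- The graph of the gradient on `W^{1,1}_0(Ω)`. -/
noncomputable def zeroGraph (Ω : Set (E d)) : Submodule ℝ (L1 Ω × L1Field Ω) :=
  (testPairs Ω).topologicalClosure

lemma isClosed_zeroGraph : IsClosed (zeroGraph Ω : Set (L1 Ω × L1Field Ω)) :=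
  Submodule.isClosed_topologicalClosure _

lemma IsTestFunction.exists_mem_testPairs {φ : E d → ℝ} (hφ : IsTestFunction Ω φ) :
    ∃ p ∈ testPairs Ω, p.1 =ᵐ[volume.restrict Ω] φ ∧ p.2 =ᵐ[volume.restrict Ω] ∇ φ := by
  have h1 : Integrable φ (volume.restrict Ω) := hφ.integrable.integrableOn
  have h2 : Integrable (∇ φ) (volume.restrict Ω) := hφ.integrable_gradient.integrableOn
  exact ⟨(h1.toL1 φ, h2.toL1 (∇ φ)), ⟨φ, hφ, h1.coeFn_toL1, h2.coeFn_toL1⟩,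
    h1.coeFn_toL1, h2.coeFn_toL1⟩

lemma mem_zeroGraph_of_approx {p : L1 Ω × L1Field Ω}
    (h : ∀ ε : ℝ≥0∞, 0 < ε → ∃ φ : E d → ℝ, IsTestFunction Ω φ ∧
      (∫⁻ x in Ω, ‖φ x - p.1 x‖ₑ) + (∫⁻ x in Ω, ‖∇ φ x - p.2 x‖ₑ) < ε) :
    p ∈ zeroGraph Ω := by
  refine EMetric.mem_closure_iff.2 fun ε hε => ?_
  obtain ⟨φ, hφ, hlt⟩ := h ε hε
  obtain ⟨q, hq, h1, h2⟩ := hφ.exists_mem_testPairs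
  refine ⟨q, hq, ?_⟩
  rw [Prod.edist_eq, L1.edist_eq_of_ae_eq h1, L1.edist_eq_of_ae_eq h2]
  exact lt_of_le_of_lt (max_le le_self_add le_add_self) hlt

lemma exists_approx_of_mem_zeroGraph {p : L1 Ω × L1Field Ω} (hp : p ∈ zeroGraph Ω)
    {ε : ℝ≥0∞} (hε : 0 < ε) : ∃ φ : E d → ℝ, IsTestFunction Ω φ ∧
      (∫⁻ x in Ω, ‖φ x - p.1 x‖ₑ) + (∫⁻ x in Ω, ‖∇ φ x - p.2 x‖ₑ) < ε := by
  obtain ⟨q, ⟨φ, hφ, h1, h2⟩, hlt⟩ := EMetric.mem_closure_iff.1 hp (ε / 2) (ENNReal.half_pos hε.ne')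
  refine ⟨φ, hφ, ?_⟩
  rw [Prod.edist_eq, L1.edist_eq_of_ae_eq h1, L1.edist_eq_of_ae_eq h2, max_lt_iff] at hlt
  simpa using ENNReal.add_lt_add hlt.1 hlt.2

lemma integrable_smul_gradient {φ : E d → ℝ} (hφ : IsTestFunction Ω φ) {w : E d → ℝ}
    (hw : IntegrableOn w Ω) : IntegrableOn (fun x => w x • ∇ φ x) Ω := by
  obtain ⟨C, hC⟩ := hφ.continuous_gradient.bounded_above_of_compact_support
    hφ.hasCompactSupport_gradient
  exact hw.smul_bdd C (hφ.continuous_gradient.aestronglyMeasurable) (ae_of_all _ hC)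

lemma integrable_test_smul {φ : E d → ℝ} (hφ : IsTestFunction Ω φ) {H : E d → E d}
    (hH : IntegrableOn H Ω) : IntegrableOn (fun x => φ x • H x) Ω := by
  obtain ⟨C, hC⟩ := hφ.smooth.continuous.bounded_above_of_compact_support hφ.compact
  exact hH.bdd_smul C hφ.smooth.continuous.aestronglyMeasurable (ae_of_all _ hC)

/-- The elements of `zeroGraph Ω` are functions together with their weak gradients. -/
lemma isWeakGradient_of_mem_zeroGraph {p : L1 Ω × L1Field Ω} (hp : p ∈ zeroGraph Ω) :
    IsWeakGradient Ω p.1 p.2 := by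
  refine ⟨L1.integrable_coeFn p.2, fun φ hφ => ?_⟩
  -- For a fixed test function both sides of the identity are Lipschitz in `L¹`, so it passes from
  -- the test pairs to their closure.
  have hcl : IsClosed {p : L1 Ω × L1Field Ω |
      ∫ x in Ω, p.1 x • ∇ φ x = - ∫ x in Ω, φ x • p.2 x} := by
    obtain ⟨C, hC⟩ := hφ.continuous_gradient.bounded_above_of_compact_support
      hφ.hasCompactSupport_gradient
    obtain ⟨C', hC'⟩ := hφ.smooth.continuous.bounded_above_of_compact_support hφ.compact
    have c1 : Continuous fun w : L1 Ω => ∫ x in Ω, w x • ∇ φ x := by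
      refine (lipschitzWith_integral_comp_lp (M := C.toNNReal) (T := fun x a => a • ∇ φ x)
        (fun x a b => ?_)
        fun f => integrable_smul_gradient hφ (L1.integrable_coeFn f)).continuous
      rw [← sub_smul, norm_smul, mul_comm]
      gcongr
      exact (hC x).trans (Real.le_coe_toNNReal C)
    have c2 : Continuous fun H : L1Field Ω => ∫ x in Ω, φ x • H x := by
      refine (lipschitzWith_integral_comp_lp (M := C'.toNNReal) (T := fun x a => φ x • a)
        (fun x a b => ?_)
        fun f => integrable_test_smul hφ (L1.integrable_coeFn f)).continuous
      rw [← smul_sub, norm_smul]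
      gcongr
      exact (hC' x).trans (Real.le_coe_toNNReal C')
    exact isClosed_eq (c1.comp continuous_fst) (c2.comp continuous_snd).neg
  refine closure_minimal ?_ hcl hp
  rintro q ⟨ψ, hψ, h1, h2⟩
  have e1 : ∫ x in Ω, q.1 x • ∇ φ x = ∫ x in Ω, ψ x • ∇ φ x :=
    integral_congr_ae (by filter_upwards [h1] with x hx; rw [hx])
  have e2 : ∫ x in Ω, φ x • q.2 x = ∫ x in Ω, φ x • ∇ ψ x :=
    integral_congr_ae (by filter_upwards [h2] with x hx; rw [hx])
  change _ = _
  rw [e1, e2]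
  exact hφ.integral_smul_gradient hψ

/-- Carrying the gradient along as an `L¹` class turns membership into a closed linear condition, to
which convexity and completeness arguments apply. -/
lemma mem_W11Zero_iff {w : L1 Ω} : w ∈ W11Zero Ω ↔ ∃ H : L1Field Ω, (w, H) ∈ zeroGraph Ω := by
  constructor
  · rintro ⟨G, hG, happ⟩
    refine ⟨hG.1.toL1 G, mem_zeroGraph_of_approx fun ε hε => ?_⟩
    obtain ⟨φ, hφ, hlt⟩ := happ ε hε
    refine ⟨φ, hφ, ?_⟩
    convert hlt using 2
    refine lintegral_congr_ae ?_
    filter_upwards [hG.1.coeFn_toL1] with x hx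
    rw [hx]
  · rintro ⟨H, hH⟩
    exact ⟨H, isWeakGradient_of_mem_zeroGraph hH, fun ε hε => exists_approx_of_mem_zeroGraph hH hε⟩

/-- Poincaré's inequality in `W^{1,1}_0(Ω)`. -/
lemma exists_poincare (hd : 0 < d) (hΩ : Bornology.IsBounded Ω) :
    ∃ C : ℝ, 0 ≤ C ∧ ∀ p ∈ zeroGraph Ω, ‖p.1‖ ≤ C * ‖p.2‖ := by
  obtain ⟨v, hv⟩ := exists_translate_disjoint hd hΩ
  refine ⟨‖v‖, norm_nonneg v, fun p hp => ?_⟩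
  have hcl : IsClosed {p : L1 Ω × L1Field Ω | ‖p.1‖ ≤ ‖v‖ * ‖p.2‖} :=
    isClosed_le (by fun_prop) (by fun_prop)
  refine closure_minimal ?_ hcl hp
  rintro q ⟨φ, hφ, h1, h2⟩
  have h := hφ.lintegral_enorm_le hv
  have e1 : ‖q.1‖ₑ = ∫⁻ x in Ω, ‖φ x‖ₑ := by
    rw [Lp.enorm_def, eLpNorm_one_eq_lintegral_enorm]
    exact lintegral_congr_ae (by filter_upwards [h1] with x hx; rw [hx])
  have e2 : ‖q.2‖ₑ = ∫⁻ x in Ω, ‖∇ φ x‖ₑ := by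
    rw [Lp.enorm_def, eLpNorm_one_eq_lintegral_enorm]
    exact lintegral_congr_ae (by filter_upwards [h2] with x hx; rw [hx])
  rw [← e1, ← e2] at h
  have h' := ENNReal.toReal_mono (by finiteness) h
  simpa using h'

/-- Uniqueness of weak gradients. -/
lemma IsWeakGradient.ae_eq (hΩ : IsOpen Ω) {u : L1 Ω} {G G' : E d → E d}
    (hG : IsWeakGradient Ω u G) (hG' : IsWeakGradient Ω u G') :
    G =ᵐ[volume.restrict Ω] G' := by
  have h : ∀ᵐ x, x ∈ Ω → (G - G') x = 0 := by
    refine hΩ.ae_eq_zero_of_integral_contDiff_smul_eq_zero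
      (hG.1.sub hG'.1).locallyIntegrableOn fun φ h1 h2 h3 => ?_
    have hφ : IsTestFunction Ω φ := ⟨h1, h2, h3⟩
    rw [← setIntegral_eq_integral_of_forall_compl_eq_zero
      (s := Ω) (fun x hx => by rw [hφ.eq_zero hx, zero_smul])]
    simp only [Pi.sub_apply, smul_sub]
    rw [integral_sub (integrable_test_smul hφ hG.1) (integrable_test_smul hφ hG'.1), sub_eq_zero,
      ← neg_inj, ← hG.2 φ hφ, ← hG'.2 φ hφ]
  rw [EventuallyEq, ae_restrict_iff' hΩ.measurableSet]
  filter_upwards [h] with x hx hxΩ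
  exact sub_eq_zero.1 (hx hxΩ)

lemma IsWeakGradient.congr {u : L1 Ω} {G G' : E d → E d}
    (hG : IsWeakGradient Ω u G) (h : G =ᵐ[volume.restrict Ω] G') : IsWeakGradient Ω u G' := by
  refine ⟨hG.1.congr h, fun φ hφ => ?_⟩
  rw [hG.2 φ hφ]
  congr 1
  exact integral_congr_ae (by filter_upwards [h] with x hx; rw [hx])

lemma IsWeakGradient.add {u v : L1 Ω} {G H : E d → E d}
    (hG : IsWeakGradient Ω u G) (hH : IsWeakGradient Ω v H) :
    IsWeakGradient Ω (u + v) (fun x => G x + H x) := by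
  refine ⟨hG.1.add hH.1, fun φ hφ => ?_⟩
  simp only [smul_add]
  rw [integral_add (integrable_test_smul hφ hG.1) (integrable_test_smul hφ hH.1), neg_add,
    ← hG.2 φ hφ, ← hH.2 φ hφ, ← integral_add
      (integrable_smul_gradient hφ (L1.integrable_coeFn u))
      (integrable_smul_gradient hφ (L1.integrable_coeFn v))]
  refine integral_congr_ae ?_
  filter_upwards [Lp.coeFn_add u v] with x hx
  rw [hx, Pi.add_apply, add_smul]

lemma energy_eq (hΩ : IsOpen Ω) (F : E d → ℝ≥0∞) {u : L1 Ω} {G : E d → E d}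
    (hG : IsWeakGradient Ω u G) : energy F Ω u = ∫⁻ x in Ω, F (G x) := by
  refine le_antisymm (iInf₂_le G hG) (le_iInf₂ fun G' hG' => ?_)
  exact (lintegral_congr_ae (by filter_upwards [hG.ae_eq hΩ hG'] with x hx; rw [hx])).le

lemma exists_isWeakGradient_of_energy_lt_top {F : E d → ℝ≥0∞} {u : L1 Ω}
    (h : energy F Ω u < ⊤) : ∃ G : L1Field Ω, IsWeakGradient Ω u G := by
  have : ∃ G : E d → E d, IsWeakGradient Ω u G := by
    by_contra! hne
    simp [energy, hne] at h
  obtain ⟨G, hG⟩ := this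
  exact ⟨hG.1.toL1 G, hG.congr hG.1.coeFn_toL1.symm⟩

end ZeroGraph

/-! ### Smooth approximation of the positive part. -/

section SmoothPositivePart

/-- A smooth nonnegative function which agrees with `s ↦ max s 0` up to `1 / k`. -/
noncomputable def smoothPosPart (k s : ℝ) : ℝ := ∫ r in (0 : ℝ)..s, Real.smoothTransition (k * r)

variable {k : ℝ}

lemma continuous_smoothTransition_mul (k : ℝ) :
    Continuous fun r => Real.smoothTransition (k * r) :=
  Real.smoothTransition.continuous.comp (by fun_prop)

lemma hasDerivAt_smoothPosPart (k s : ℝ) :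
    HasDerivAt (smoothPosPart k) (Real.smoothTransition (k * s)) s :=
  (continuous_smoothTransition_mul k).integral_hasStrictDerivAt 0 s |>.hasDerivAt

lemma deriv_smoothPosPart (k : ℝ) :
    deriv (smoothPosPart k) = fun s => Real.smoothTransition (k * s) :=
  funext fun s => (hasDerivAt_smoothPosPart k s).deriv

lemma contDiff_smoothPosPart (k : ℝ) : ContDiff ℝ ∞ (smoothPosPart k) := by
  rw [contDiff_infty_iff_deriv, deriv_smoothPosPart]
  exact ⟨fun s => (hasDerivAt_smoothPosPart k s).differentiableAt,
    Real.smoothTransition.contDiff.comp (by fun_prop)⟩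

lemma smoothPosPart_zero (k : ℝ) : smoothPosPart k 0 = 0 := by simp [smoothPosPart]

lemma abs_smoothTransition_le (s : ℝ) : |Real.smoothTransition s| ≤ 1 := by
  rw [abs_of_nonneg (Real.smoothTransition.nonneg s)]
  exact Real.smoothTransition.le_one s

lemma lipschitzWith_smoothPosPart (k : ℝ) : LipschitzWith 1 (smoothPosPart k) := by
  refine lipschitzWith_of_nnnorm_deriv_le
    (fun s => (hasDerivAt_smoothPosPart k s).differentiableAt) fun s => ?_
  rw [deriv_smoothPosPart]
  exact abs_smoothTransition_le _

lemma abs_smoothPosPart_le (k s : ℝ) : |smoothPosPart k s| ≤ |s| := by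
  simpa [smoothPosPart_zero] using (lipschitzWith_smoothPosPart k).dist_le_mul s 0

/-- The transition function vanishes on the whole closed negative half-line, so the limit at `s = 0`
is `0`; this fixes the strict inequality in the gradient of a positive part. -/
lemma tendsto_smoothTransition_mul (s : ℝ) :
    Tendsto (fun n : ℕ => Real.smoothTransition (n * s)) atTop (𝓝 (if 0 < s then 1 else 0)) := by
  split_ifs with hs
  · refine tendsto_const_nhds.congr' ?_
    filter_upwards [(tendsto_natCast_atTop_atTop (R := ℝ)).eventually_ge_atTop (1 / s)] with n hn
    exact (Real.smoothTransition.one_of_one_le ((div_le_iff₀ hs).1 hn)).symm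
  · refine tendsto_const_nhds.congr fun n => ?_
    exact (Real.smoothTransition.zero_of_nonpos
      (mul_nonpos_of_nonneg_of_nonpos n.cast_nonneg (not_lt.1 hs))).symm

lemma tendsto_smoothPosPart (s : ℝ) :
    Tendsto (fun n : ℕ => smoothPosPart n s) atTop (𝓝 (max s 0)) := by
  have h : Tendsto (fun n : ℕ => smoothPosPart n s) atTop
      (𝓝 (∫ r in (0 : ℝ)..s, if 0 < r then (1 : ℝ) else 0)) := by
    refine intervalIntegral.tendsto_integral_filter_of_dominated_convergence (fun _ => 1)
      (Eventually.of_forall fun n =>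
        (continuous_smoothTransition_mul n).aestronglyMeasurable)
      (Eventually.of_forall fun n => ae_of_all _ fun r _ => abs_smoothTransition_le _)
      intervalIntegrable_const (ae_of_all _ fun r _ => tendsto_smoothTransition_mul r)
  convert h using 2
  rcases le_total 0 s with hs | hs
  · rw [max_eq_left hs, intervalIntegral.integral_of_le hs,
      setIntegral_congr_fun (g := fun _ => (1 : ℝ)) measurableSet_Ioc fun r hr => if_pos hr.1]
    simp [hs]
  · rw [max_eq_right hs, intervalIntegral.integral_of_ge hs,
      setIntegral_congr_fun (g := fun _ => (0 : ℝ)) measurableSet_Ioc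
        fun r hr => if_neg (not_lt.2 hr.2)]
    simp

end SmoothPositivePart

/-! ### Multiplication of a field by a bounded function of `w`, in `L¹`. -/

section MulComp

variable {α F : Type*} {mα : MeasurableSpace α} {μ : Measure α}
  [NormedAddCommGroup F]

lemma tendsto_L1_of_dominated {f : ℕ → Lp F 1 μ} {g : Lp F 1 μ} {b : α → ℝ} (hb : Integrable b μ)
    (hle : ∀ n, ∀ᵐ x ∂μ, ‖f n x‖ ≤ b x)
    (hlim : ∀ᵐ x ∂μ, Tendsto (fun n => f n x) atTop (𝓝 (g x))) :
    Tendsto f atTop (𝓝 g) := by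
  have h := tendsto_lintegral_norm_of_dominated_convergence
    (fun n => (Lp.aestronglyMeasurable (f n))) hb.2 hle hlim
  rw [tendsto_iff_edist_tendsto_0]
  refine h.congr fun n => ?_
  rw [L1.edist_def]
  refine lintegral_congr fun x => ?_
  rw [edist_dist, dist_eq_norm]

variable [NormedSpace ℝ F]

lemma integrable_comp_smul {γ : ℝ → ℝ} (hγ : Measurable γ) (hb : ∀ s, |γ s| ≤ 1)
    (p : Lp ℝ 1 μ × Lp F 1 μ) : Integrable (fun x => γ (p.1 x) • p.2 x) μ :=
  (L1.integrable_coeFn p.2).bdd_smul 1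
    (hγ.comp_aemeasurable (Lp.aestronglyMeasurable p.1).aemeasurable).aestronglyMeasurable
    (ae_of_all _ fun _ => hb _)

/-- The vector field `γ(w) H`, for a bounded function `γ`. -/
noncomputable def compSmul {γ : ℝ → ℝ} (hγ : Measurable γ) (hb : ∀ s, |γ s| ≤ 1)
    (p : Lp ℝ 1 μ × Lp F 1 μ) : Lp F 1 μ :=
  (integrable_comp_smul hγ hb p).toL1 _

variable {γ : ℝ → ℝ} (hγ : Measurable γ) (hb : ∀ s, |γ s| ≤ 1)

lemma coeFn_compSmul (p : Lp ℝ 1 μ × Lp F 1 μ) :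
    compSmul hγ hb p =ᵐ[μ] fun x => γ (p.1 x) • p.2 x :=
  (integrable_comp_smul hγ hb p).coeFn_toL1

lemma norm_compSmul_le (p : Lp ℝ 1 μ × Lp F 1 μ) :
    ∀ᵐ x ∂μ, ‖compSmul hγ hb p x‖ ≤ ‖p.2 x‖ := by
  filter_upwards [coeFn_compSmul hγ hb p] with x hx
  rw [hx, norm_smul]
  exact mul_le_of_le_one_left (norm_nonneg _) (hb _)

lemma dist_compSmul_le (w : Lp ℝ 1 μ) (H H' : Lp F 1 μ) :
    dist (compSmul hγ hb (w, H)) (compSmul hγ hb (w, H')) ≤ dist H H' := by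
  have h : compSmul hγ hb (w, H) - compSmul hγ hb (w, H') = compSmul hγ hb (w, H - H') := by
    apply Lp.ext
    filter_upwards [coeFn_compSmul hγ hb (w, H), coeFn_compSmul hγ hb (w, H'),
      coeFn_compSmul hγ hb (w, H - H'), Lp.coeFn_sub (compSmul hγ hb (w, H))
        (compSmul hγ hb (w, H')), Lp.coeFn_sub H H'] with x h1 h2 h3 h4 h5
    rw [h4, Pi.sub_apply, h1, h2, h3, h5, Pi.sub_apply, smul_sub]
  rw [dist_eq_norm, dist_eq_norm, h]
  exact Lp.norm_le_norm_of_ae_le (norm_compSmul_le hγ hb _)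

/-- With the field frozen, dominated convergence along a.e. convergent subsequences handles the
weight; changing the field costs at most its `L¹` distance because `|γ| ≤ 1`. -/
lemma continuous_compSmul (hc : Continuous γ) :
    Continuous (compSmul (μ := μ) (F := F) hγ hb) := by
  rw [continuous_iff_seqContinuous]
  intro p q hpq
  have h1 : Tendsto (fun n => (p n).1) atTop (𝓝 q.1) := (continuous_fst.tendsto q).comp hpq
  have h2 : Tendsto (fun n => (p n).2) atTop (𝓝 q.2) := (continuous_snd.tendsto q).comp hpq
  have h3 : Tendsto (fun n => compSmul hγ hb ((p n).1, q.2)) atTop (𝓝 (compSmul hγ hb q)) := by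
    refine tendsto_of_subseq_tendsto fun ns hns => ?_
    obtain ⟨ms, -, hms⟩ :=
      (tendstoInMeasure_of_tendsto_Lp (h1.comp hns)).exists_seq_tendsto_ae
    refine ⟨ms, tendsto_L1_of_dominated (L1.integrable_coeFn q.2).norm
      (fun n => norm_compSmul_le hγ hb _) ?_⟩
    filter_upwards [hms, coeFn_compSmul hγ hb q,
      ae_all_iff.2 fun n => coeFn_compSmul hγ hb ((p (ns (ms n))).1, q.2)] with x hx h4 h5
    rw [h4]
    simp only [h5]
    exact ((hc.tendsto _).comp hx).smul_const _
  refine tendsto_of_tendsto_of_dist h3 ?_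
  refine squeeze_zero (fun _ => dist_nonneg) (fun n => ?_) (tendsto_iff_dist_tendsto_zero.1 h2)
  rw [dist_comm]
  exact dist_compSmul_le hγ hb (p n).1 (p n).2 q.2

end MulComp

/-! ### Chain rule and truncation in `W^{1,1}_0`. -/

section ZeroGraph

variable {d : ℕ} {Ω : Set (E d)}

/-- Chain rule in `W^{1,1}_0(Ω)`. -/
lemma comp_mem_zeroGraph {β : ℝ → ℝ} (hβ : ContDiff ℝ ∞ β) (h0 : β 0 = 0)
    (hL : LipschitzWith 1 β) (hm : Measurable (deriv β)) (hb : ∀ s, |deriv β s| ≤ 1)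
    {p : L1 Ω × L1Field Ω} (hp : p ∈ zeroGraph Ω) :
    (hL.compLp h0 p.1, compSmul hm hb p) ∈ zeroGraph Ω := by
  have hc : Continuous fun p : L1 Ω × L1Field Ω => (hL.compLp h0 p.1, compSmul hm hb p) :=
    ((hL.continuous_compLp h0).comp continuous_fst).prodMk
      (continuous_compSmul hm hb (hβ.continuous_deriv (by simp)))
  refine map_mem_closure (f := fun p : L1 Ω × L1Field Ω => (hL.compLp h0 p.1, compSmul hm hb p))
    (s := (testPairs Ω : Set (L1 Ω × L1Field Ω))) (t := testPairs Ω) hc hp ?_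
  rintro q ⟨φ, hφ, h1, h2⟩
  refine ⟨β ∘ φ, hφ.comp hβ h0, ?_, ?_⟩
  · filter_upwards [hL.coeFn_compLp h0 q.1, h1] with x hx hx'
    rw [hx, Function.comp_apply, Function.comp_apply, hx']
  · filter_upwards [coeFn_compSmul hm hb q, h1, h2] with x hx hx' hx''
    rw [hx, hφ.gradient_comp hβ, hx', hx'']

/-- `W^{1,1}_0(Ω)` is stable under taking positive parts. -/
lemma sup_zero_mem_zeroGraph {p : L1 Ω × L1Field Ω} (hp : p ∈ zeroGraph Ω) :
    ∃ H : L1Field Ω, (p.1 ⊔ 0, H) ∈ zeroGraph Ω ∧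
      ∀ᵐ x ∂(volume.restrict Ω), H x = if 0 < p.1 x then p.2 x else 0 := by
  have hm : ∀ k : ℝ, Measurable (deriv (smoothPosPart k)) := fun k => measurable_deriv _
  have hb : ∀ k s : ℝ, |deriv (smoothPosPart k) s| ≤ 1 := fun k s => by
    rw [deriv_smoothPosPart]
    exact abs_smoothTransition_le _
  have hm' : Measurable fun s : ℝ => if 0 < s then (1 : ℝ) else 0 :=
    Measurable.ite measurableSet_Ioi measurable_const measurable_const
  have hb' : ∀ s : ℝ, |if 0 < s then (1 : ℝ) else 0| ≤ 1 := fun s => by split_ifs <;> simp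
  have hind := coeFn_compSmul hm' hb' p
  refine ⟨compSmul hm' hb' p, ?_, ?_⟩
  -- Apply the chain rule to the smooth approximations and let `n → ∞`: functions and gradients are
  -- dominated by `|w|` and `|∇w|`, and the graph is closed.
  · refine isClosed_zeroGraph.mem_of_tendsto (b := atTop)
      (f := fun n : ℕ => ((lipschitzWith_smoothPosPart n).compLp (smoothPosPart_zero n) p.1,
        compSmul (hm n) (hb n) p)) (Tendsto.prodMk_nhds ?_ ?_) (Eventually.of_forall fun n =>
          comp_mem_zeroGraph (contDiff_smoothPosPart n) _ _ _ _ hp)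
    · refine tendsto_L1_of_dominated (L1.integrable_coeFn p.1).norm (fun n => ?_) ?_
      · filter_upwards [(lipschitzWith_smoothPosPart n).coeFn_compLp (smoothPosPart_zero n) p.1]
          with x hx
        rw [hx]
        exact abs_smoothPosPart_le _ _
      · filter_upwards [ae_all_iff.2 fun n : ℕ => (lipschitzWith_smoothPosPart n).coeFn_compLp
          (smoothPosPart_zero n) p.1, Lp.coeFn_sup p.1 0, Lp.coeFn_zero ℝ 1 (volume.restrict Ω)]
          with x h1 h2 h3
        rw [h2, Pi.sup_apply, h3]
        simp only [h1]
        exact tendsto_smoothPosPart _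
    · refine tendsto_L1_of_dominated (L1.integrable_coeFn p.2).norm
        (fun n => norm_compSmul_le _ _ p) ?_
      filter_upwards [ae_all_iff.2 fun n : ℕ => coeFn_compSmul (hm n) (hb n) p, hind]
        with x h1 h2
      rw [h2]
      have h3 : Tendsto (fun n : ℕ => deriv (smoothPosPart n) (p.1 x) • p.2 x) atTop
          (𝓝 ((if 0 < p.1 x then (1 : ℝ) else 0) • p.2 x)) := by
        simp only [deriv_smoothPosPart]
        exact (tendsto_smoothTransition_mul (p.1 x)).smul_const (p.2 x)
      exact h3.congr fun n => (h1 n).symm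
  · filter_upwards [hind] with x hx
    rw [hx]
    split_ifs <;> simp

end ZeroGraph

/-! ### Quantitative strict convexity of `√(1 + |p|²)`. -/

section RegularNorm

variable {V : Type*} [NormedAddCommGroup V]

/-- The regularized norm `√(1 + |p|²)`. -/
noncomputable def regNorm (p : V) : ℝ := √(1 + ‖p‖ ^ 2)

lemma continuous_regNorm : Continuous (regNorm : V → ℝ) := by
  unfold regNorm
  fun_prop

lemma regNorm_nonneg (p : V) : 0 ≤ regNorm p := Real.sqrt_nonneg _

lemma regNorm_sq (p : V) : regNorm p ^ 2 = 1 + ‖p‖ ^ 2 := Real.sq_sqrt (by positivity)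

lemma regNorm_le (p : V) : regNorm p ≤ 1 + ‖p‖ :=
  Real.sqrt_le_iff.2 ⟨by positivity, by nlinarith [norm_nonneg p]⟩

variable [InnerProductSpace ℝ V]

/-- The defect of convexity of the regularized norm at the midpoint. -/
noncomputable def convexityGap (p q : V) : ℝ :=
  regNorm p + regNorm q - 2 * regNorm ((2⁻¹ : ℝ) • p + (2⁻¹ : ℝ) • q)

lemma continuous_convexityGap : Continuous fun x : V × V => convexityGap x.1 x.2 := by
  unfold convexityGap
  have := continuous_regNorm (V := V)
  fun_prop

lemma convexityGap_pos {p q : V} (h : p ≠ q) : 0 < convexityGap p q := by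
  have hA := regNorm_sq p
  have hB := regNorm_sq q
  have hM := regNorm_sq ((2⁻¹ : ℝ) • p + (2⁻¹ : ℝ) • q)
  have hA0 := regNorm_nonneg p
  have hB0 := regNorm_nonneg q
  have hM0 := regNorm_nonneg ((2⁻¹ : ℝ) • p + (2⁻¹ : ℝ) • q)
  have hAp : 0 < regNorm p := by nlinarith [norm_nonneg p]
  have hpq : 0 < ‖p - q‖ ^ 2 := by
    have := norm_pos_iff.2 (sub_ne_zero.2 h)
    positivity
  have h1 := norm_sub_sq_real p q
  have h2 := norm_add_sq_real ((2⁻¹ : ℝ) • p) ((2⁻¹ : ℝ) • q)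
  have hcs := real_inner_le_norm p q
  rw [norm_smul, norm_smul, inner_smul_left, inner_smul_right] at h2
  norm_num at h2
  set A := regNorm p
  set B := regNorm q
  set M := regNorm ((2⁻¹ : ℝ) • p + (2⁻¹ : ℝ) • q)
  set c := inner ℝ p q
  have hc2 : c ^ 2 ≤ ‖p‖ ^ 2 * ‖q‖ ^ 2 := by
    have := sq_le_sq' (neg_le_of_abs_le (abs_real_inner_le_norm p q)) hcs
    rwa [mul_pow] at this
  -- Strict Cauchy–Schwarz for the vectors `(1, p)` and `(1, q)`, which are not parallel when `p ≠
  -- q`.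
  have hAB : 1 + c < A * B := by
    by_contra! hle
    have h3 : (A * B) ^ 2 ≤ (1 + c) ^ 2 := pow_le_pow_left₀ (by positivity) hle 2
    rw [mul_pow, hA, hB] at h3
    nlinarith
  have hlt : (2 * M) ^ 2 < (A + B) ^ 2 := by nlinarith
  have := lt_of_pow_lt_pow_left₀ 2 (by positivity) hlt
  change 0 < A + B - 2 * M
  linarith

lemma convexityGap_nonneg (p q : V) : 0 ≤ convexityGap p q := by
  rcases eq_or_ne p q with rfl | h
  · have : (2⁻¹ : ℝ) • p + (2⁻¹ : ℝ) • p = p := by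
      rw [← add_smul]
      norm_num
    rw [convexityGap, this]
    linarith
  · exact (convexityGap_pos h).le

/-- On the compact set of pairs in the ball at distance at least `δ`, the gap has a positive
minimum, while `‖p - q‖ ≤ 2R`. -/
lemma exists_norm_sub_le_gap [FiniteDimensional ℝ V] {δ : ℝ} (hδ : 0 < δ) (R : ℝ) :
    ∃ K : ℝ, 0 ≤ K ∧ ∀ p q : V, ‖p‖ ≤ R → ‖q‖ ≤ R → ‖p - q‖ ≤ δ + K * convexityGap p q := by
  set S : Set (V × V) := (Metric.closedBall 0 R ×ˢ Metric.closedBall 0 R) ∩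
    {x | δ ≤ ‖x.1 - x.2‖} with hS
  have hSc : IsCompact S :=
    ((isCompact_closedBall 0 R).prod (isCompact_closedBall 0 R)).inter_right
      (isClosed_le (by fun_prop) (by fun_prop))
  rcases S.eq_empty_or_nonempty with he | hne
  · refine ⟨0, le_rfl, fun p q hp hq => ?_⟩
    by_contra! hlt
    have : (p, q) ∈ S := ⟨⟨by simpa using hp, by simpa using hq⟩, by
      change δ ≤ ‖p - q‖
      linarith⟩
    simp [he] at this
  · obtain ⟨x, hx, hmin⟩ := hSc.exists_isMinOn hne continuous_convexityGap.continuousOn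
    have hxne : x.1 ≠ x.2 := by
      intro h
      have := hx.2
      simp [h] at this
      linarith
    have hc : 0 < convexityGap x.1 x.2 := convexityGap_pos hxne
    have hR : 0 ≤ R := (norm_nonneg x.1).trans (by simpa using hx.1.1)
    refine ⟨2 * R / convexityGap x.1 x.2, by positivity, fun p q hp hq => ?_⟩
    have hg := convexityGap_nonneg p q
    rcases le_total δ ‖p - q‖ with h | h
    · have h1 : convexityGap x.1 x.2 ≤ convexityGap p q :=
        hmin (a := (p, q)) ⟨⟨by simpa using hp, by simpa using hq⟩, h⟩
      have h2 : ‖p - q‖ ≤ 2 * R := (norm_sub_le p q).trans (by linarith)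
      have h3 : 2 * R ≤ 2 * R / convexityGap x.1 x.2 * convexityGap p q := by
        rw [div_mul_eq_mul_div, le_div_iff₀ hc]
        gcongr
      linarith
    · have : 0 ≤ 2 * R / convexityGap x.1 x.2 * convexityGap p q := by positivity
      linarith

end RegularNorm

/-! ### Strong compactness from superlinearity and convexity. -/

section Compactness

variable {d : ℕ} {F : E d → ℝ≥0∞}

lemma Superlinear.exists_tail (hF : Superlinear F) {η : ℝ} (hη : 0 < η) :
    ∃ R : ℝ, 0 ≤ R ∧ ∀ p, R < ‖p‖ → ‖p‖ₑ ≤ ENNReal.ofReal η * F p := by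
  have h : ∀ᶠ p in Bornology.cobounded (E d), ENNReal.ofReal η⁻¹ < F p / ‖p‖ₑ :=
    hF.eventually (lt_mem_nhds ENNReal.ofReal_lt_top)
  obtain ⟨R, -, hR⟩ := (hasBasis_cobounded_norm.eventually_iff).1 h
  refine ⟨max R 0, le_max_right _ _, fun p hp => ?_⟩
  have hp' : 0 < ‖p‖ := (le_max_right _ _).trans_lt hp
  have h1 := hR (show p ∈ {x | R ≤ ‖x‖} from ((le_max_left _ _).trans_lt hp).le)
  have h2 : ENNReal.ofReal η⁻¹ * ‖p‖ₑ ≤ F p := by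
    refine ENNReal.mul_le_of_le_div h1.le
  calc ‖p‖ₑ = ENNReal.ofReal η * (ENNReal.ofReal η⁻¹ * ‖p‖ₑ) := by
        rw [← mul_assoc, ← ENNReal.ofReal_mul hη.le, mul_inv_cancel₀ hη.ne', ENNReal.ofReal_one,
          one_mul]
    _ ≤ ENNReal.ofReal η * F p := by gcongr

variable {α : Type*} {mα : MeasurableSpace α} {μ : Measure α}

/-- The part of the `L¹` norm which comes from the values larger than `R`. -/
noncomputable def tailNorm (R : ℝ) (G : Lp (E d) 1 μ) : ℝ :=
  ∫ x, (if R < ‖G x‖ then ‖G x‖ else 0) ∂μ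

lemma integrable_tail (R : ℝ) (G : Lp (E d) 1 μ) :
    Integrable (fun x => if R < ‖G x‖ then ‖G x‖ else 0) μ := by
  refine (L1.integrable_coeFn G).norm.mono ?_ (ae_of_all _ fun x => ?_)
  · have hm : Measurable fun s : ℝ => if R < s then s else 0 :=
      Measurable.ite measurableSet_Ioi measurable_id measurable_const
    exact (hm.comp_aemeasurable
      (Lp.aestronglyMeasurable G).norm.aemeasurable).aestronglyMeasurable
  · split_ifs <;> simp

lemma tailNorm_le {η R M : ℝ} (hη : 0 ≤ η)
    (hR : ∀ p, R < ‖p‖ → ‖p‖ₑ ≤ ENNReal.ofReal η * F p) (hM : 0 ≤ M)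
    {G : Lp (E d) 1 μ} (hG : ∫⁻ x, F (G x) ∂μ ≤ ENNReal.ofReal M) : tailNorm R G ≤ η * M := by
  rw [tailNorm, integral_eq_lintegral_of_nonneg_ae (ae_of_all _ fun x => by
    change 0 ≤ ite _ _ _
    split_ifs <;> simp) (integrable_tail R G).aestronglyMeasurable]
  refine ENNReal.toReal_le_of_le_ofReal (by positivity) ?_
  calc ∫⁻ x, ENNReal.ofReal (if R < ‖G x‖ then ‖G x‖ else 0) ∂μ
      ≤ ∫⁻ x, ENNReal.ofReal η * F (G x) ∂μ := by
        refine lintegral_mono fun x => ?_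
        split_ifs with h
        · rw [ofReal_norm]
          exact hR _ h
        · simp
    _ = ENNReal.ofReal η * ∫⁻ x, F (G x) ∂μ := lintegral_const_mul' _ _ ENNReal.ofReal_ne_top
    _ ≤ ENNReal.ofReal (η * M) := by
        rw [ENNReal.ofReal_mul hη]
        gcongr

/-- The integral of the regularized norm. -/
noncomputable def regNormIntegral (G : Lp (E d) 1 μ) : ℝ := ∫ x, regNorm (G x) ∂μ

lemma regNormIntegral_nonneg (G : Lp (E d) 1 μ) : 0 ≤ regNormIntegral G :=
  integral_nonneg fun _ => regNorm_nonneg _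

variable [IsFiniteMeasure μ]

lemma integrable_regNorm (G : Lp (E d) 1 μ) : Integrable (fun x => regNorm (G x)) μ := by
  refine ((integrable_const (1 : ℝ)).add (L1.integrable_coeFn G).norm).mono
    (continuous_regNorm.comp_aestronglyMeasurable (Lp.aestronglyMeasurable G))
    (ae_of_all _ fun x => ?_)
  rw [Real.norm_of_nonneg (regNorm_nonneg _)]
  exact (regNorm_le _).trans (le_abs_self _)

lemma regNormIntegral_le {R : ℝ} (hR : 0 ≤ R) (G : Lp (E d) 1 μ) :
    regNormIntegral G ≤ (1 + R) * μ.real univ + tailNorm R G := by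
  calc regNormIntegral G ≤ ∫ x, ((1 + R) + if R < ‖G x‖ then ‖G x‖ else 0) ∂μ := by
        refine integral_mono (integrable_regNorm G)
          ((integrable_const _).add (integrable_tail R G)) fun x => ?_
        refine (regNorm_le _).trans ?_
        change _ ≤ (1 + R) + ite _ _ _
        split_ifs with h <;> linarith
    _ = _ := by
        rw [integral_add (integrable_const _) (integrable_tail R G)]
        simp [tailNorm, mul_comm]

/-- Where both fields are at most `R` the pointwise gap estimate applies; elsewhere at least one is
in its tail, and twice the sum of the two tails absorbs `‖G x - G' x‖` up to the nonnegative terms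
`δ` and `K` times the gap. -/
lemma norm_sub_le_gap {δ R K : ℝ} (hδ : 0 ≤ δ) (hK : 0 ≤ K)
    (h : ∀ p q : E d, ‖p‖ ≤ R → ‖q‖ ≤ R → ‖p - q‖ ≤ δ + K * convexityGap p q)
    (G G' : Lp (E d) 1 μ) :
    ‖G - G'‖ ≤ δ * μ.real univ + K * (regNormIntegral G + regNormIntegral G' -
      2 * regNormIntegral ((2⁻¹ : ℝ) • G + (2⁻¹ : ℝ) • G')) + 2 * (tailNorm R G + tailNorm R G') := by
  have hmid : ∀ᵐ x ∂μ, ((2⁻¹ : ℝ) • G + (2⁻¹ : ℝ) • G') x = (2⁻¹ : ℝ) • G x + (2⁻¹ : ℝ) • G' x := by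
    filter_upwards [Lp.coeFn_add ((2⁻¹ : ℝ) • G) ((2⁻¹ : ℝ) • G'), Lp.coeFn_smul (2⁻¹ : ℝ) G,
      Lp.coeFn_smul (2⁻¹ : ℝ) G'] with x h1 h2 h3
    rw [h1, Pi.add_apply, h2, h3, Pi.smul_apply, Pi.smul_apply]
  have i1 := integrable_regNorm G
  have i2 := integrable_regNorm G'
  have i3 := integrable_regNorm ((2⁻¹ : ℝ) • G + (2⁻¹ : ℝ) • G')
  have i4 := integrable_tail R G
  have i5 := integrable_tail R G'
  have i6 : Integrable (fun x => regNorm (G x) + regNorm (G' x) -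
      2 * regNorm (((2⁻¹ : ℝ) • G + (2⁻¹ : ℝ) • G') x)) μ := (i1.add i2).sub (i3.const_mul 2)
  have i7 : Integrable (fun x => δ + K * (regNorm (G x) + regNorm (G' x) -
      2 * regNorm (((2⁻¹ : ℝ) • G + (2⁻¹ : ℝ) • G') x))) μ :=
    (integrable_const δ).add (i6.const_mul K)
  have i8 : Integrable (fun x => 2 * ((if R < ‖G x‖ then ‖G x‖ else 0) +
      if R < ‖G' x‖ then ‖G' x‖ else 0)) μ := (i4.add i5).const_mul 2
  rw [L1.norm_eq_integral_norm]
  calc ∫ x, ‖(G - G') x‖ ∂μ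
      ≤ ∫ x, ((δ + K * (regNorm (G x) + regNorm (G' x) -
          2 * regNorm (((2⁻¹ : ℝ) • G + (2⁻¹ : ℝ) • G') x))) +
          2 * ((if R < ‖G x‖ then ‖G x‖ else 0) + if R < ‖G' x‖ then ‖G' x‖ else 0)) ∂μ := by
        refine integral_mono_ae (L1.integrable_coeFn (G - G')).norm (i7.add i8) ?_
        filter_upwards [hmid, Lp.coeFn_sub G G'] with x h1 h2
        rw [h1, h2, Pi.sub_apply]
        have hg := convexityGap_nonneg (G x) (G' x)
        have hg' := mul_nonneg hK hg
        have hn := norm_sub_le (G x) (G' x)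
        have n1 := norm_nonneg (G x)
        have n2 := norm_nonneg (G' x)
        change _ ≤ δ + K * convexityGap (G x) (G' x) + _
        split_ifs with h3 h4 h4
        · linarith
        · linarith
        · linarith
        · have := h _ _ (not_lt.1 h3) (not_lt.1 h4)
          linarith
    _ = _ := by
        rw [integral_add i7 i8, integral_add (integrable_const δ) (i6.const_mul K),
          integral_const_mul, integral_const_mul, integral_add i4 i5,
          integral_sub (f := fun x => regNorm (G x) + regNorm (G' x)) (i1.add i2)
            (i3.const_mul 2), integral_add i1 i2, integral_const_mul]
        simp [tailNorm, regNormIntegral, mul_comm]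

/-- Decreasing convex sets of vector fields of bounded energy, for a superlinear energy density,
contain a strongly convergent selection. -/
lemma exists_cauchySeq_selection (hF : Superlinear F) {D : ℕ → Set (Lp (E d) 1 μ)}
    (hanti : Antitone D) (hne : ∀ n, (D n).Nonempty) (hconv : ∀ n, Convex ℝ (D n)) {M : ℝ}
    (hM : 0 ≤ M) (hbd : ∀ G ∈ D 0, ∫⁻ x, F (G x) ∂μ ≤ ENNReal.ofReal M) :
    ∃ G : ℕ → Lp (E d) 1 μ, (∀ n, G n ∈ D n) ∧ CauchySeq G := by
  have hbd' : ∀ n, ∀ G ∈ D n, ∫⁻ x, F (G x) ∂μ ≤ ENNReal.ofReal M :=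
    fun n G hG => hbd G (hanti (Nat.zero_le n) hG)
  -- The infima increase with `n` and are bounded. For near-minimizers the midpoint lies in `D n` by
  -- convexity, so the integrated gap is controlled by `L - a n` and the selection error.
  set a : ℕ → ℝ := fun n => sInf (regNormIntegral '' D n) with ha
  have hbb : ∀ n, BddBelow (regNormIntegral '' D n) := fun n =>
    ⟨0, by rintro _ ⟨G, -, rfl⟩; exact regNormIntegral_nonneg G⟩
  have hale : ∀ n, ∀ G ∈ D n, a n ≤ regNormIntegral G := fun n G hG =>
    csInf_le (hbb n) (mem_image_of_mem _ hG)
  have hmono : Monotone a := fun n m hnm =>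
    csInf_le_csInf (hbb n) ((hne m).image _) (image_mono (hanti hnm))
  have habove : BddAbove (range a) := by
    obtain ⟨R, hR0, hR⟩ := hF.exists_tail one_pos
    refine ⟨(1 + R) * μ.real univ + 1 * M, ?_⟩
    rintro _ ⟨n, rfl⟩
    obtain ⟨G, hG⟩ := hne n
    exact (hale n G hG).trans ((regNormIntegral_le hR0 G).trans
      (by gcongr; exact tailNorm_le zero_le_one hR hM (hbd' n G hG)))
  have hsel : ∀ n : ℕ, ∃ G ∈ D n, regNormIntegral G < a n + 1 / ((n : ℝ) + 1) := by
    intro n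
    have hpos : (0 : ℝ) < 1 / ((n : ℝ) + 1) := by positivity
    obtain ⟨_, ⟨G, hG, rfl⟩, hlt⟩ := exists_lt_of_csInf_lt ((hne n).image _)
      (lt_add_of_pos_right (a n) hpos)
    exact ⟨G, hG, hlt⟩
  choose G hGD hG using hsel
  refine ⟨G, hGD, ?_⟩
  set L := ⨆ n, a n
  have haL : Tendsto a atTop (𝓝 L) := tendsto_atTop_ciSup hmono habove
  have hgap : ∀ n m, n ≤ m → regNormIntegral (G n) + regNormIntegral (G m) -
      2 * regNormIntegral ((2⁻¹ : ℝ) • G n + (2⁻¹ : ℝ) • G m) ≤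
        (L - a n) + 2 * (1 / ((n : ℝ) + 1)) := by
    intro n m hnm
    have h1 := hale n _ (hconv n (hGD n) (hanti hnm (hGD m)) (a := 2⁻¹) (b := 2⁻¹)
      (by norm_num) (by norm_num) (by norm_num))
    have h2 : 1 / ((m : ℝ) + 1) ≤ 1 / ((n : ℝ) + 1) := by gcongr
    have h3 : a m ≤ L := le_ciSup habove m
    linarith [hG n, hG m]
  have hlim : Tendsto (fun n : ℕ => (L - a n) + 2 * (1 / ((n : ℝ) + 1))) atTop (𝓝 0) := by
    have := (haL.const_sub L).add (tendsto_one_div_add_atTop_nhds_zero_nat (𝕜 := ℝ) |>.const_mul 2)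
    simpa using this
  refine Metric.cauchySeq_iff'.2 fun ε hε => ?_
  have hμ : 0 ≤ μ.real univ := measureReal_nonneg
  -- The constants make each of the three contributions (`δ` term, gap, tails) at most `ε / 4`.
  obtain ⟨R, hR0, hR⟩ := hF.exists_tail (η := ε / (16 * (M + 1))) (by positivity)
  obtain ⟨K, hK0, hK⟩ := exists_norm_sub_le_gap (V := E d)
    (δ := ε / (4 * (μ.real univ + 1))) (by positivity) R
  have hev := ((hlim.const_mul K).eventually (gt_mem_nhds (show K * 0 < ε / 4 by
    rw [mul_zero]
    positivity))).exists
  obtain ⟨N, hN⟩ := hev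
  refine ⟨N, fun n hn => ?_⟩
  rw [dist_comm, dist_eq_norm]
  have ht : ∀ n, tailNorm R (G n) ≤ ε / 16 := fun n => by
    refine (tailNorm_le (by positivity) hR hM (hbd' n _ (hGD n))).trans ?_
    rw [div_mul_eq_mul_div, div_le_div_iff₀ (by positivity) (by norm_num)]
    nlinarith
  have h1 := norm_sub_le_gap (μ := μ) (by positivity) hK0 hK (G N) (G n)
  have h2 := mul_le_mul_of_nonneg_left (hgap N n hn) hK0
  have h3 : ε / (4 * (μ.real univ + 1)) * μ.real univ ≤ ε / 4 := by
    rw [div_mul_eq_mul_div, div_le_div_iff₀ (by positivity) (by norm_num)]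
    nlinarith
  linarith [ht N, ht n]

end Compactness

/-! ### Convexity and lower semicontinuity of the integral functional. -/

section Integrand

variable {d : ℕ} {F : E d → ℝ≥0∞}

lemma StrictlyConvex.le (hF : StrictlyConvex F) (p q : E d) {a b : ℝ} (ha : 0 ≤ a) (hb : 0 ≤ b)
    (hab : a + b = 1) : F (a • p + b • q) ≤ ENNReal.ofReal a * F p + ENNReal.ofReal b * F q := by
  rcases ha.eq_or_lt with rfl | ha'
  · obtain rfl : b = 1 := by linarith
    simp
  rcases hb.eq_or_lt with rfl | hb'
  · obtain rfl : a = 1 := by linarith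
    simp
  rcases eq_or_ne p q with rfl | hpq
  · rw [← add_smul, hab, one_smul, ← add_mul, ← ENNReal.ofReal_add ha hb, hab, ENNReal.ofReal_one,
      one_mul]
  by_cases hp : F p = ⊤
  · simp [hp, ENNReal.mul_top, ha']
  by_cases hq : F q = ⊤
  · simp [hq, ENNReal.mul_top, hb']
  exact (hF p q hpq hp hq a.toNNReal b.toNNReal (by simpa) (by simpa)
    (by rw [← Real.toNNReal_add ha hb, hab, Real.toNNReal_one])).le.trans' (by
      rw [NNReal.smul_def, NNReal.smul_def, Real.coe_toNNReal a ha, Real.coe_toNNReal b hb])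

variable {α : Type*} {mα : MeasurableSpace α} {μ : Measure α}

lemma aemeasurable_comp_lp (hF : LowerSemicontinuous F) (G : Lp (E d) 1 μ) :
    AEMeasurable (fun x => F (G x)) μ :=
  hF.measurable.comp_aemeasurable (Lp.aestronglyMeasurable G).aemeasurable

lemma ae_lp_combination (G G' : Lp (E d) 1 μ) (a b : ℝ) :
    ∀ᵐ x ∂μ, (a • G + b • G') x = a • G x + b • G' x := by
  filter_upwards [Lp.coeFn_add (a • G) (b • G'), Lp.coeFn_smul a G, Lp.coeFn_smul b G']
    with x h1 h2 h3
  rw [h1, Pi.add_apply, h2, h3, Pi.smul_apply, Pi.smul_apply]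

lemma lintegral_combination (hF : LowerSemicontinuous F) (G G' : Lp (E d) 1 μ) (a b : ℝ) :
    ∫⁻ x, (ENNReal.ofReal a * F (G x) + ENNReal.ofReal b * F (G' x)) ∂μ =
      ENNReal.ofReal a * ∫⁻ x, F (G x) ∂μ + ENNReal.ofReal b * ∫⁻ x, F (G' x) ∂μ := by
  rw [lintegral_add_left' ((aemeasurable_comp_lp hF G).const_mul _),
    lintegral_const_mul' _ _ ENNReal.ofReal_ne_top, lintegral_const_mul' _ _ ENNReal.ofReal_ne_top]

lemma lintegral_comp_convex (hF : LowerSemicontinuous F) (hFc : StrictlyConvex F)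
    (G G' : Lp (E d) 1 μ) {a b : ℝ} (ha : 0 ≤ a) (hb : 0 ≤ b) (hab : a + b = 1) :
    ∫⁻ x, F ((a • G + b • G') x) ∂μ ≤
      ENNReal.ofReal a * ∫⁻ x, F (G x) ∂μ + ENNReal.ofReal b * ∫⁻ x, F (G' x) ∂μ := by
  rw [← lintegral_combination hF]
  refine lintegral_mono_ae ?_
  filter_upwards [ae_lp_combination G G' a b] with x hx
  rw [hx]
  exact hFc.le _ _ ha hb hab

lemma lintegral_comp_strict (hF : LowerSemicontinuous F) (hFc : StrictlyConvex F)
    {G G' : Lp (E d) 1 μ} (hne : G ≠ G') (hG : ∫⁻ x, F (G x) ∂μ < ⊤)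
    (hG' : ∫⁻ x, F (G' x) ∂μ < ⊤) :
    ∫⁻ x, F (((2⁻¹ : ℝ) • G + (2⁻¹ : ℝ) • G') x) ∂μ <
      ENNReal.ofReal 2⁻¹ * ∫⁻ x, F (G x) ∂μ + ENNReal.ofReal 2⁻¹ * ∫⁻ x, F (G' x) ∂μ := by
  have hle := lintegral_comp_convex hF hFc G G' (a := 2⁻¹) (b := 2⁻¹) (by norm_num) (by norm_num)
    (by norm_num)
  rw [← lintegral_combination hF]
  have hmid := ae_lp_combination G G' 2⁻¹ 2⁻¹
  have hμ : μ {x | G x ≠ G' x} ≠ 0 := fun h => hne (Lp.ext (ae_iff.2 h))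
  refine lintegral_strict_mono_of_ae_le_of_ae_lt_on
    (((aemeasurable_comp_lp hF G).const_mul _).add ((aemeasurable_comp_lp hF G').const_mul _))
    (hle.trans_lt (by finiteness)).ne ?_ hμ ?_
  · filter_upwards [hmid] with x hx
    rw [hx]
    exact hFc.le _ _ (by norm_num) (by norm_num) (by norm_num)
  · filter_upwards [hmid, ae_lt_top' (aemeasurable_comp_lp hF G) hG.ne,
      ae_lt_top' (aemeasurable_comp_lp hF G') hG'.ne] with x hx h1 h2 h3
    rw [hx]
    have h := hFc _ _ h3 h1.ne h2.ne 2⁻¹ 2⁻¹ (by norm_num) (by norm_num)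
      (by rw [← two_mul, mul_inv_cancel₀ two_ne_zero])
    rw [NNReal.smul_def, NNReal.smul_def] at h
    have e : ENNReal.ofReal 2⁻¹ = ((2⁻¹ : ℝ≥0) : ℝ≥0∞) := by
      rw [ENNReal.ofReal, Real.toNNReal_inv]
      simp
    rw [e]
    simpa using h

/-- Fatou's lemma along an a.e. convergent subsequence. -/
lemma lowerSemicontinuous_lintegral_comp (hF : LowerSemicontinuous F) :
    LowerSemicontinuous fun G : Lp (E d) 1 μ => ∫⁻ x, F (G x) ∂μ := by
  rw [lowerSemicontinuous_iff_isClosed_preimage]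
  intro c
  refine IsSeqClosed.isClosed fun G G' hG hlim => ?_
  obtain ⟨ns, -, hns⟩ := (tendstoInMeasure_of_tendsto_Lp hlim).exists_seq_tendsto_ae
  change ∫⁻ x, F (G' x) ∂μ ≤ c
  calc ∫⁻ x, F (G' x) ∂μ ≤ ∫⁻ x, liminf (fun i => F (G (ns i) x)) atTop ∂μ := by
        refine lintegral_mono_ae ?_
        filter_upwards [hns] with x hx
        refine le_of_forall_lt fun y hy => ?_
        obtain ⟨z, hyz, hz⟩ := exists_between hy
        refine hyz.trans_le (le_liminf_of_le (by isBoundedDefault) ?_)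
        exact (hx.eventually (hF (G' x) z hz)).mono fun _ h => h.le
    _ ≤ liminf (fun i => ∫⁻ x, F (G (ns i) x) ∂μ) atTop :=
        lintegral_liminf_le' fun i => aemeasurable_comp_lp hF _
    _ ≤ c := liminf_le_of_le (by isBoundedDefault) fun b hb => by
        obtain ⟨i, hi⟩ := hb.exists
        exact hi.trans (hG (ns i))

end Integrand

/-! ### The Dirichlet energy in terms of gradients. -/

section DirichletEnergy

variable {d : ℕ} {Ω : Set (E d)} {F : E d → ℝ≥0∞} {u0 : L1 Ω} {G0 : L1Field Ω}

lemma isWeakGradient_add (hG0 : IsWeakGradient Ω u0 G0) {u : L1 Ω} {H : L1Field Ω}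
    (h : (u - u0, H) ∈ zeroGraph Ω) : IsWeakGradient Ω u (G0 + H : L1Field Ω) := by
  have h1 := (hG0.add (isWeakGradient_of_mem_zeroGraph h)).congr (Lp.coeFn_add G0 H).symm
  rwa [add_sub_cancel] at h1

lemma dirichletEnergy_eq (hΩ : IsOpen Ω) (hG0 : IsWeakGradient Ω u0 G0) {u : L1 Ω}
    {H : L1Field Ω} (h : (u - u0, H) ∈ zeroGraph Ω) :
    dirichletEnergy F Ω u0 u = ∫⁻ x in Ω, F ((G0 + H : L1Field Ω) x) := by
  have hw : u - u0 ∈ W11Zero Ω := mem_W11Zero_iff.2 ⟨H, h⟩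
  rw [dirichletEnergy, iInf_pos hw, energy_eq hΩ F (isWeakGradient_add hG0 h)]

lemma exists_mem_zeroGraph_of_lt_top {u : L1 Ω} (h : dirichletEnergy F Ω u0 u < ⊤) :
    ∃ H, (u - u0, H) ∈ zeroGraph Ω := by
  by_contra hne
  rw [← mem_W11Zero_iff] at hne
  simp [dirichletEnergy, hne] at h

lemma dirichletEnergy_eq_energy {u : L1 Ω} (h : u - u0 ∈ W11Zero Ω) :
    dirichletEnergy F Ω u0 u = energy F Ω u := by
  rw [dirichletEnergy, iInf_pos h]

lemma dirichletEnergy_self : dirichletEnergy F Ω u0 u0 = energy F Ω u0 :=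
  dirichletEnergy_eq_energy (mem_W11Zero_iff.2 ⟨0, by
    rw [sub_self]
    exact (zeroGraph Ω).zero_mem⟩)

/-- Decreasing closed convex subsets of the graph of the gradient, of bounded energy, have a
common point. -/
lemma exists_mem_iInter_of_bounded_energy (hd : 0 < d) (hΩb : Bornology.IsBounded Ω)
    (hFs : Superlinear F)
    {C : ℕ → Set (L1 Ω × L1Field Ω)} (hanti : Antitone C) (hne : ∀ n, (C n).Nonempty)
    (hconv : ∀ n, Convex ℝ (C n)) (hcl : ∀ n, IsClosed (C n)) (hsub : C 0 ⊆ zeroGraph Ω)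
    {M : ℝ≥0∞} (hM : M < ⊤)
    (hbd : ∀ p ∈ C 0, ∫⁻ x in Ω, F ((G0 + p.2 : L1Field Ω) x) ≤ M) : ∃ p, ∀ n, p ∈ C n := by
  have : IsFiniteMeasure ((volume : Measure (E d)).restrict Ω) :=
    ⟨by simpa using hΩb.measure_lt_top⟩
  obtain ⟨G, hG, hcau⟩ := exists_cauchySeq_selection (μ := volume.restrict Ω) hFs
    (D := fun n => (fun p => G0 + p.2) '' C n)
    (fun n m h => image_mono (hanti h)) (fun n => (hne n).image _) (fun n => by
      rintro _ ⟨p, hp, rfl⟩ _ ⟨q, hq, rfl⟩ a b ha hb hab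
      refine ⟨a • p + b • q, hconv n hp hq ha hb hab, ?_⟩
      simp only [Prod.snd_add, Prod.smul_snd, smul_add]
      rw [add_add_add_comm, ← add_smul, hab, one_smul])
    (M := M.toReal) ENNReal.toReal_nonneg (by
      rintro _ ⟨p, hp, rfl⟩
      rw [ENNReal.ofReal_toReal hM.ne]
      exact hbd p hp)
  choose p hp hpG using hG
  have hp0 : ∀ n, p n ∈ zeroGraph Ω := fun n => hsub (hanti (Nat.zero_le n) (hp n))
  -- The selection controls only gradients; Poincaré's inequality makes the functions Cauchy as
  -- well.
  obtain ⟨K, hK0, hK⟩ := exists_poincare (Ω := Ω) hd hΩb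
  have hc2 : CauchySeq fun n => (p n).2 := by
    have h1 : (fun n => (p n).2) = fun n => -G0 + G n := by
      ext1 n
      rw [← hpG n, neg_add_cancel_left]
    rw [h1]
    exact (uniformContinuous_const.add uniformContinuous_id).comp_cauchySeq hcau
  have hc1 : CauchySeq fun n => (p n).1 := by
    rw [Metric.cauchySeq_iff] at hc2 ⊢
    intro ε hε
    obtain ⟨N, hN⟩ := hc2 (ε / (K + 1)) (by positivity)
    refine ⟨N, fun m hm n hn => ?_⟩
    have h1 := hK _ ((zeroGraph Ω).sub_mem (hp0 m) (hp0 n))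
    have h2 := hN m hm n hn
    rw [dist_eq_norm] at h2 ⊢
    rw [lt_div_iff₀ (by positivity)] at h2
    change ‖(p m).1 - (p n).1‖ ≤ K * ‖(p m).2 - (p n).2‖ at h1
    nlinarith [norm_nonneg ((p m).2 - (p n).2)]
  obtain ⟨w, hw⟩ := cauchySeq_tendsto_of_complete hc1
  obtain ⟨H, hH⟩ := cauchySeq_tendsto_of_complete hc2
  refine ⟨(w, H), fun n => (hcl n).mem_of_tendsto (hw.prodMk_nhds hH) ?_⟩
  filter_upwards [eventually_ge_atTop n] with m hm
  exact hanti hm (hp m)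

lemma lintegral_shift_convex (hFl : LowerSemicontinuous F) (hFc : StrictlyConvex F)
    (H H' : L1Field Ω) {a b : ℝ} (ha : 0 ≤ a) (hb : 0 ≤ b) (hab : a + b = 1) :
    ∫⁻ x in Ω, F ((G0 + (a • H + b • H') : L1Field Ω) x) ≤
      ENNReal.ofReal a * (∫⁻ x in Ω, F ((G0 + H : L1Field Ω) x)) +
        ENNReal.ofReal b * (∫⁻ x in Ω, F ((G0 + H' : L1Field Ω) x)) := by
  have e : G0 + (a • H + b • H') = a • (G0 + H) + b • (G0 + H') := by
    rw [smul_add, smul_add, add_add_add_comm, ← add_smul, hab, one_smul]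
  rw [e]
  exact lintegral_comp_convex hFl hFc (G0 + H) (G0 + H') ha hb hab

end DirichletEnergy

/-! ### The abstract energy, and its verification for the Dirichlet energy. -/

/-- The properties of the Dirichlet energy on which the evolution depends: convexity, strict
convexity, submodularity, lower semicontinuity, solvability of the implicit step. -/
structure IsLatticeEnergy {α : Type*} {mα : MeasurableSpace α} {μ : Measure α}
    (Φ : Lp ℝ 1 μ → ℝ≥0∞) : Prop where
  convex : ∀ (u v : Lp ℝ 1 μ) (a b : ℝ), 0 ≤ a → 0 ≤ b → a + b = 1 →
    Φ (a • u + b • v) ≤ ENNReal.ofReal a * Φ u + ENNReal.ofReal b * Φ v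
  strict : ∀ u v : Lp ℝ 1 μ, u ≠ v → Φ u < ⊤ → Φ v < ⊤ →
    Φ ((2⁻¹ : ℝ) • u + (2⁻¹ : ℝ) • v) < ENNReal.ofReal 2⁻¹ * Φ u + ENNReal.ofReal 2⁻¹ * Φ v
  submodular : ∀ u v : Lp ℝ 1 μ, Φ (u ⊔ v) + Φ (u ⊓ v) ≤ Φ u + Φ v
  isClosed : ∀ c : ℝ≥0∞, c < ⊤ → IsClosed {u | Φ u ≤ c}
  exists_step : ∀ (w : Lp ℝ 1 μ) (τ : ℝ), 0 < τ → ∃ u : Lp ℝ 1 μ, ∀ v : Lp ℝ 1 μ,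
    Φ u + ENNReal.ofReal (‖u - w‖ ^ 2 / (2 * τ)) ≤ Φ v + ENNReal.ofReal (‖v - w‖ ^ 2 / (2 * τ))

section

variable {d : ℕ} {Ω : Set (E d)} {F : E d → ℝ≥0∞} {u0 : L1 Ω} {G0 : L1Field Ω}

lemma combination_mem_zeroGraph {u v : L1 Ω} {H H' : L1Field Ω}
    (hu : (u - u0, H) ∈ zeroGraph Ω) (hv : (v - u0, H') ∈ zeroGraph Ω) {a b : ℝ}
    (hab : a + b = 1) : (a • u + b • v - u0, a • H + b • H') ∈ zeroGraph Ω := by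
  have h := (zeroGraph Ω).add_mem ((zeroGraph Ω).smul_mem a hu) ((zeroGraph Ω).smul_mem b hv)
  have e : a • u + b • v - u0 = a • (u - u0) + b • (v - u0) := by
    rw [smul_sub, smul_sub, sub_add_sub_comm, ← add_smul, hab, one_smul]
  rw [e]
  exact h

lemma dirichletEnergy_convex (hΩ : IsOpen Ω) (hFl : LowerSemicontinuous F)
    (hFc : StrictlyConvex F) (hG0 : IsWeakGradient Ω u0 G0) (u v : L1 Ω) {a b : ℝ} (ha : 0 ≤ a)
    (hb : 0 ≤ b) (hab : a + b = 1) :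
    dirichletEnergy F Ω u0 (a • u + b • v) ≤ ENNReal.ofReal a * dirichletEnergy F Ω u0 u +
      ENNReal.ofReal b * dirichletEnergy F Ω u0 v := by
  rcases ha.eq_or_lt with rfl | ha'
  · obtain rfl : b = 1 := by linarith
    simp
  rcases hb.eq_or_lt with rfl | hb'
  · obtain rfl : a = 1 := by linarith
    simp
  rcases (le_top (a := dirichletEnergy F Ω u0 u)).eq_or_lt with h1 | h1
  · simp [h1, ENNReal.mul_top, ha']
  rcases (le_top (a := dirichletEnergy F Ω u0 v)).eq_or_lt with h2 | h2
  · simp [h2, ENNReal.mul_top, hb']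
  obtain ⟨H, hH⟩ := exists_mem_zeroGraph_of_lt_top h1
  obtain ⟨H', hH'⟩ := exists_mem_zeroGraph_of_lt_top h2
  rw [dirichletEnergy_eq hΩ hG0 hH, dirichletEnergy_eq hΩ hG0 hH',
    dirichletEnergy_eq hΩ hG0 (combination_mem_zeroGraph hH hH' hab)]
  exact lintegral_shift_convex hFl hFc H H' ha hb hab

lemma dirichletEnergy_strict (hd : 0 < d) (hΩ : IsOpen Ω) (hΩb : Bornology.IsBounded Ω)
    (hFl : LowerSemicontinuous F) (hFc : StrictlyConvex F) (hG0 : IsWeakGradient Ω u0 G0)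
    {u v : L1 Ω} (hne : u ≠ v) (h1 : dirichletEnergy F Ω u0 u < ⊤)
    (h2 : dirichletEnergy F Ω u0 v < ⊤) :
    dirichletEnergy F Ω u0 ((2⁻¹ : ℝ) • u + (2⁻¹ : ℝ) • v) <
      ENNReal.ofReal 2⁻¹ * dirichletEnergy F Ω u0 u +
        ENNReal.ofReal 2⁻¹ * dirichletEnergy F Ω u0 v := by
  obtain ⟨H, hH⟩ := exists_mem_zeroGraph_of_lt_top h1
  obtain ⟨H', hH'⟩ := exists_mem_zeroGraph_of_lt_top h2
  have hab : (2⁻¹ : ℝ) + 2⁻¹ = 1 := by norm_num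
  rw [dirichletEnergy_eq hΩ hG0 hH] at h1 ⊢
  rw [dirichletEnergy_eq hΩ hG0 hH'] at h2 ⊢
  rw [dirichletEnergy_eq hΩ hG0 (combination_mem_zeroGraph hH hH' hab)]
  -- Distinct functions with the same boundary values have distinct gradients, by Poincaré; so
  -- strict convexity of `F` carries over to functions.
  have hne' : G0 + H ≠ G0 + H' := by
    intro h
    obtain rfl : H = H' := add_left_cancel h
    obtain ⟨C, -, hC⟩ := exists_poincare (Ω := Ω) hd hΩb
    have h3 := hC _ ((zeroGraph Ω).sub_mem hH hH')
    simp only [Prod.mk_sub_mk, sub_sub_sub_cancel_right, sub_self, norm_zero, mul_zero] at h3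
    exact hne (sub_eq_zero.1 (norm_le_zero_iff.1 h3))
  have e : G0 + ((2⁻¹ : ℝ) • H + (2⁻¹ : ℝ) • H') =
      (2⁻¹ : ℝ) • (G0 + H) + (2⁻¹ : ℝ) • (G0 + H') := by
    rw [smul_add, smul_add, add_add_add_comm, ← add_smul, hab, one_smul]
  rw [e]
  exact lintegral_comp_strict hFl hFc hne' h1 h2

/-- With `P` the gradient of `(u - v)⁺`, the gradients of `u ⊔ v` and `u ⊓ v` are a.e. those of `u`
and `v`, in this order where `u > v` and exchanged elsewhere. The integrands thus have equal sums.
-/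
lemma dirichletEnergy_submodular (hΩ : IsOpen Ω) (hFl : LowerSemicontinuous F)
    (hG0 : IsWeakGradient Ω u0 G0) (u v : L1 Ω) :
    dirichletEnergy F Ω u0 (u ⊔ v) + dirichletEnergy F Ω u0 (u ⊓ v) ≤
      dirichletEnergy F Ω u0 u + dirichletEnergy F Ω u0 v := by
  rcases (le_top (a := dirichletEnergy F Ω u0 u)).eq_or_lt with h1 | h1
  · simp [h1]
  rcases (le_top (a := dirichletEnergy F Ω u0 v)).eq_or_lt with h2 | h2
  · simp [h2]
  obtain ⟨H, hH⟩ := exists_mem_zeroGraph_of_lt_top h1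
  obtain ⟨H', hH'⟩ := exists_mem_zeroGraph_of_lt_top h2
  have hsub := (zeroGraph Ω).sub_mem hH hH'
  simp only [Prod.mk_sub_mk, sub_sub_sub_cancel_right] at hsub
  obtain ⟨P, hP, hPae⟩ := sup_zero_mem_zeroGraph hsub
  have hsup : (u ⊔ v - u0, H' + P) ∈ zeroGraph Ω := by
    have e : u ⊔ v - u0 = (v - u0) + (u - v) ⊔ 0 := by
      rw [← sub_self v, ← sup_sub]
      abel
    rw [e]
    exact (zeroGraph Ω).add_mem hH' hP
  have hinf : (u ⊓ v - u0, H - P) ∈ zeroGraph Ω := by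
    have e : u ⊓ v - u0 = (u - u0) - (u - v) ⊔ 0 := by
      rw [← sub_self v, ← sup_sub, eq_sub_of_add_eq (inf_add_sup u v)]
      abel
    rw [e]
    exact (zeroGraph Ω).sub_mem hH hP
  rw [dirichletEnergy_eq hΩ hG0 hH, dirichletEnergy_eq hΩ hG0 hH', dirichletEnergy_eq hΩ hG0 hsup,
    dirichletEnergy_eq hΩ hG0 hinf, ← lintegral_add_left' (aemeasurable_comp_lp hFl _),
    ← lintegral_add_left' (aemeasurable_comp_lp hFl _)]
  refine (lintegral_congr_ae ?_).le
  filter_upwards [hPae, Lp.coeFn_sub H H', Lp.coeFn_add G0 H, Lp.coeFn_add G0 H',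
    Lp.coeFn_add G0 (H' + P), Lp.coeFn_add G0 (H - P), Lp.coeFn_add H' P, Lp.coeFn_sub H P]
    with x k1 k2 k3 k4 k5 k6 k7 k8
  simp only [k3, k4, k5, k6, Pi.add_apply, k7, k8, Pi.sub_apply, k1, k2]
  split_ifs
  · rw [add_sub_cancel, sub_sub_cancel]
  · rw [add_zero, sub_zero, add_comm]

lemma lowerSemicontinuous_shift (hFl : LowerSemicontinuous F) :
    LowerSemicontinuous fun p : L1 Ω × L1Field Ω => ∫⁻ x in Ω, F ((G0 + p.2 : L1Field Ω) x) :=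
  (lowerSemicontinuous_lintegral_comp (μ := volume.restrict Ω) hFl).comp
    (g := fun p : L1 Ω × L1Field Ω => G0 + p.2) (by fun_prop)

/-- `L¹` convergence of the functions says nothing about strong convergence of their gradients.
Instead, the pairs of energy at most `c` whose function is within `1 / (n + 1)` of the limit form
decreasing closed convex sets, and a common point supplies the gradient of the limit. -/
lemma isClosed_dirichletEnergy_le (hd : 0 < d) (hΩ : IsOpen Ω) (hΩb : Bornology.IsBounded Ω)
    (hFl : LowerSemicontinuous F) (hFc : StrictlyConvex F) (hFs : Superlinear F)
    (hG0 : IsWeakGradient Ω u0 G0) {c : ℝ≥0∞} (hc : c < ⊤) :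
    IsClosed {u | dirichletEnergy F Ω u0 u ≤ c} := by
  refine isClosed_of_closure_subset fun u hu => ?_
  have hpos : ∀ n : ℕ, (0 : ℝ) < 1 / ((n : ℝ) + 1) := fun n => by positivity
  obtain ⟨p, hp⟩ := exists_mem_iInter_of_bounded_energy (F := F) (G0 := G0) hd hΩb hFs
    (C := fun n => zeroGraph Ω ∩ ({p | ∫⁻ x in Ω, F ((G0 + p.2 : L1Field Ω) x) ≤ c} ∩
      {p | p.1 ∈ Metric.closedBall (u - u0) (1 / ((n : ℝ) + 1))}))
    (fun n m hnm => inter_subset_inter_right _ (inter_subset_inter_right _ fun p hp =>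
      Metric.closedBall_subset_closedBall (by gcongr) hp))
    (fun n => by
      obtain ⟨v, hv, hlt⟩ := Metric.mem_closure_iff.1 hu _ (hpos n)
      obtain ⟨H, hH⟩ := exists_mem_zeroGraph_of_lt_top (lt_of_le_of_lt hv hc)
      refine ⟨(v - u0, H), hH, ?_, ?_⟩
      · change dirichletEnergy F Ω u0 v ≤ c at hv
        rwa [dirichletEnergy_eq hΩ hG0 hH] at hv
      · change v - u0 ∈ Metric.closedBall (u - u0) _
        rw [Metric.mem_closedBall, dist_sub_right, dist_comm]
        exact hlt.le)
    (fun n => by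
      refine (zeroGraph Ω).convex.inter (Convex.inter ?_ ?_)
      · intro p hp q hq a b ha hb hab
        refine (lintegral_shift_convex hFl hFc p.2 q.2 ha hb hab).trans ?_
        calc _ ≤ ENNReal.ofReal a * c + ENNReal.ofReal b * c := by
              gcongr
              · exact hp
              · exact hq
          _ = c := by rw [← add_mul, ← ENNReal.ofReal_add ha hb, hab, ENNReal.ofReal_one, one_mul]
      · exact (convex_closedBall _ _).linear_preimage (LinearMap.fst ℝ (L1 Ω) (L1Field Ω)))
    (fun n => isClosed_zeroGraph.inter
      (((lowerSemicontinuous_shift hFl).isClosed_preimage c).inter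
        (Metric.isClosed_closedBall.preimage continuous_fst)))
    inter_subset_left hc (fun p hp => hp.2.1)
  have h1 : p.1 = u - u0 := by
    refine eq_of_dist_eq_zero (le_antisymm (ge_of_tendsto'
      (tendsto_one_div_add_atTop_nhds_zero_nat (𝕜 := ℝ)) fun n => ?_) dist_nonneg)
    exact (hp n).2.2
  have h2 : (u - u0, p.2) ∈ zeroGraph Ω := h1 ▸ (hp 0).1
  change dirichletEnergy F Ω u0 u ≤ c
  rw [dirichletEnergy_eq hΩ hG0 h2]
  exact (hp 0).2.1

/-- The direct method, with the nested closed convex sublevels `J ≤ m + 1 / (n + 1)` in the role of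
a weakly compact minimizing sequence. -/
lemma exists_minimizer_dirichletEnergy_add (hd : 0 < d) (hΩ : IsOpen Ω)
    (hΩb : Bornology.IsBounded Ω) (hFl : LowerSemicontinuous F) (hFc : StrictlyConvex F)
    (hFs : Superlinear F) (hG0 : IsWeakGradient Ω u0 G0) (hfin : energy F Ω u0 < ⊤) {g : L1 Ω → ℝ}
    (hg : ConvexOn ℝ univ g) (hgc : Continuous g) (hg0 : ∀ u, 0 ≤ g u) :
    ∃ u : L1 Ω, ∀ v : L1 Ω, dirichletEnergy F Ω u0 u + ENNReal.ofReal (g u) ≤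
      dirichletEnergy F Ω u0 v + ENNReal.ofReal (g v) := by
  set J : L1 Ω × L1Field Ω → ℝ≥0∞ := fun p =>
    (∫⁻ x in Ω, F ((G0 + p.2 : L1Field Ω) x)) + ENNReal.ofReal (g (p.1 + u0)) with hJ
  have hJE : ∀ {u H}, (u - u0, H) ∈ zeroGraph Ω →
      J (u - u0, H) = dirichletEnergy F Ω u0 u + ENNReal.ofReal (g u) := by
    intro u H h
    rw [dirichletEnergy_eq hΩ hG0 h, hJ]
    simp only [sub_add_cancel]
  have hJl : LowerSemicontinuous J := (lowerSemicontinuous_shift hFl).add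
    (ENNReal.continuous_ofReal.comp (by fun_prop : Continuous fun p : L1 Ω × L1Field Ω =>
      g (p.1 + u0))).lowerSemicontinuous
  set m : ℝ≥0∞ := ⨅ p ∈ zeroGraph Ω, J p with hm
  have hm0 : m < ⊤ := by
    refine (iInf₂_le 0 (zeroGraph Ω).zero_mem).trans_lt ?_
    have h : (u0 - u0, (0 : L1Field Ω)) ∈ zeroGraph Ω := by
      rw [sub_self]
      exact (zeroGraph Ω).zero_mem
    have h2 := hJE h
    rw [sub_self, dirichletEnergy_self] at h2
    change J (0, 0) < ⊤
    rw [h2]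
    finiteness
  obtain ⟨p, hp⟩ := exists_mem_iInter_of_bounded_energy (F := F) (G0 := G0) hd hΩb hFs
    (C := fun n => zeroGraph Ω ∩ {p | J p ≤ m + ((n : ℝ≥0∞) + 1)⁻¹})
    (fun n k hnk => inter_subset_inter_right _ fun p (hp : J p ≤ _) => hp.trans (by gcongr))
    (fun n => by
      have h : m < m + ((n : ℝ≥0∞) + 1)⁻¹ := ENNReal.lt_add_right hm0.ne (by simp)
      obtain ⟨p, hp, hlt⟩ := by simpa only [hm, iInf_lt_iff, exists_prop] using h
      exact ⟨p, hp, hlt.le⟩)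
    (fun n => by
      refine (zeroGraph Ω).convex.inter ?_
      intro p hp q hq a b ha hb hab
      change J (a • p + b • q) ≤ _
      have e : (a • p + b • q).1 + u0 = a • (p.1 + u0) + b • (q.1 + u0) := by
        rw [smul_add, smul_add, add_add_add_comm, ← add_smul, hab, one_smul]
        rfl
      have h1 := lintegral_shift_convex (G0 := G0) hFl hFc p.2 q.2 ha hb hab
      have h2 : ENNReal.ofReal (g ((a • p + b • q).1 + u0)) ≤
          ENNReal.ofReal a * ENNReal.ofReal (g (p.1 + u0)) +
            ENNReal.ofReal b * ENNReal.ofReal (g (q.1 + u0)) := by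
        rw [e, ← ENNReal.ofReal_mul ha, ← ENNReal.ofReal_mul hb,
          ← ENNReal.ofReal_add (mul_nonneg ha (hg0 _)) (mul_nonneg hb (hg0 _))]
        exact ENNReal.ofReal_le_ofReal (hg.2 (mem_univ _) (mem_univ _) ha hb hab)
      calc J (a • p + b • q) ≤ ENNReal.ofReal a * J p + ENNReal.ofReal b * J q := by
            refine (add_le_add h1 h2).trans_eq ?_
            rw [hJ]
            ring
        _ ≤ ENNReal.ofReal a * (m + ((n : ℝ≥0∞) + 1)⁻¹) +
            ENNReal.ofReal b * (m + ((n : ℝ≥0∞) + 1)⁻¹) := by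
            gcongr
            · exact hp
            · exact hq
        _ = m + ((n : ℝ≥0∞) + 1)⁻¹ := by
            rw [← add_mul, ← ENNReal.ofReal_add ha hb, hab, ENNReal.ofReal_one, one_mul])
    (fun n => isClosed_zeroGraph.inter (hJl.isClosed_preimage _))
    inter_subset_left (M := m + 1) (by finiteness) (fun p hp => by
      have h : J p ≤ m + ((0 : ℕ) + 1 : ℝ≥0∞)⁻¹ := hp.2
      simp only [Nat.cast_zero, zero_add, inv_one] at h
      exact le_self_add.trans h)
  have hp0 : p ∈ zeroGraph Ω := (hp 0).1
  have hpm : J p ≤ m := by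
    have h1 : Tendsto (fun n : ℕ => m + ((n : ℝ≥0∞) + 1)⁻¹) atTop (𝓝 (m + 0)) := by
      refine tendsto_const_nhds.add ?_
      have := (tendsto_add_atTop_iff_nat 1).2 ENNReal.tendsto_inv_nat_nhds_zero
      simpa using this
    rw [add_zero] at h1
    exact ge_of_tendsto' h1 fun n => (hp n).2
  have hpu : (p.1 + u0 - u0, p.2) ∈ zeroGraph Ω := by rwa [add_sub_cancel_right]
  refine ⟨p.1 + u0, fun v => ?_⟩
  rcases (le_top (a := dirichletEnergy F Ω u0 v)).eq_or_lt with h1 | h1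
  · simp [h1]
  obtain ⟨H, hH⟩ := exists_mem_zeroGraph_of_lt_top h1
  rw [← hJE hpu, ← hJE hH, add_sub_cancel_right]
  exact hpm.trans (iInf₂_le _ hH)

lemma convexOn_sq_norm_sub {X : Type*} [NormedAddCommGroup X] [NormedSpace ℝ X] (w : X) {τ : ℝ}
    (hτ : 0 < τ) : ConvexOn ℝ univ fun u : X => ‖u - w‖ ^ 2 / (2 * τ) := by
  have h1 : ConvexOn ℝ univ fun u : X => ‖u - w‖ := by
    simpa [dist_eq_norm] using convexOn_univ_dist (E := X) w
  have h2 := (h1.pow (fun _ _ => norm_nonneg _) 2).smul (c := (2 * τ)⁻¹) (by positivity)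
  refine h2.congr fun u _ => ?_
  simp only [smul_eq_mul, Pi.pow_apply, div_eq_inv_mul]

lemma isLatticeEnergy_dirichletEnergy (hd : 0 < d) (hΩ : IsOpen Ω) (hΩb : Bornology.IsBounded Ω)
    (hFl : LowerSemicontinuous F) (hFc : StrictlyConvex F) (hFs : Superlinear F)
    (hfin : energy F Ω u0 < ⊤) : IsLatticeEnergy (dirichletEnergy F Ω u0) := by
  obtain ⟨G0, hG0⟩ := exists_isWeakGradient_of_energy_lt_top hfin
  exact
    { convex := fun u v a b ha hb hab => dirichletEnergy_convex hΩ hFl hFc hG0 u v ha hb hab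
      strict := fun u v hne h1 h2 => dirichletEnergy_strict hd hΩ hΩb hFl hFc hG0 hne h1 h2
      submodular := dirichletEnergy_submodular hΩ hFl hG0
      isClosed := fun c hc => isClosed_dirichletEnergy_le hd hΩ hΩb hFl hFc hFs hG0 hc
      exists_step := fun w τ hτ => exists_minimizer_dirichletEnergy_add hd hΩ hΩb hFl hFc hFs hG0
        hfin (convexOn_sq_norm_sub w hτ) (by fun_prop) (fun u => by positivity) }

end

/-! ### Mass, and `L¹` distances between ordered functions. -/

section Mass

variable {α : Type*} {mα : MeasurableSpace α} {μ : Measure α}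

/-- The integral of an integrable function. -/
noncomputable def mass (v : Lp ℝ 1 μ) : ℝ := ∫ x, v x ∂μ

lemma mass_add (u v : Lp ℝ 1 μ) : mass (u + v) = mass u + mass v := by
  rw [mass, integral_congr_ae (Lp.coeFn_add u v)]
  exact integral_add (L1.integrable_coeFn u) (L1.integrable_coeFn v)

lemma mass_sub (u v : Lp ℝ 1 μ) : mass (u - v) = mass u - mass v := by
  rw [mass, integral_congr_ae (Lp.coeFn_sub u v)]
  exact integral_sub (L1.integrable_coeFn u) (L1.integrable_coeFn v)

lemma mass_smul (c : ℝ) (u : Lp ℝ 1 μ) : mass (c • u) = c * mass u := by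
  rw [mass, integral_congr_ae (Lp.coeFn_smul c u)]
  exact integral_const_mul c _

lemma mass_sup_add_mass_inf (u v : Lp ℝ 1 μ) : mass (u ⊔ v) + mass (u ⊓ v) = mass u + mass v := by
  rw [add_comm, ← mass_add, ← mass_add, inf_add_sup]

lemma norm_sub_eq_mass {u v : Lp ℝ 1 μ} (h : u ≤ v) : ‖v - u‖ = mass v - mass u := by
  rw [← mass_sub, mass, L1.norm_eq_integral_norm]
  refine integral_congr_ae ?_
  filter_upwards [(Lp.coeFn_le _ _).2 h, Lp.coeFn_sub v u] with x h1 h2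
  rw [h2, Pi.sub_apply, Real.norm_of_nonneg (sub_nonneg.2 h1)]

lemma mass_mono {u v : Lp ℝ 1 μ} (h : u ≤ v) : mass u ≤ mass v := by
  linarith [norm_sub_eq_mass h, norm_nonneg (v - u)]

lemma norm_sub_eq_mass_sup_inf (u v : Lp ℝ 1 μ) : ‖u - v‖ = mass (u ⊔ v) - mass (u ⊓ v) := by
  rw [← norm_sub_eq_mass inf_le_sup, sup_sub_inf_eq_abs_sub, norm_abs_eq_norm, norm_sub_rev]

lemma abs_mass_sub_le (u v : Lp ℝ 1 μ) : |mass u - mass v| ≤ ‖u - v‖ := by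
  rw [← mass_sub, mass, L1.norm_eq_integral_norm]
  exact norm_integral_le_integral_norm (fun x => (u - v) x)

lemma continuous_mass : Continuous (mass : Lp ℝ 1 μ → ℝ) :=
  (LipschitzWith.of_dist_le_mul (K := 1) fun u v => by
    simpa [Real.dist_eq, dist_eq_norm] using abs_mass_sub_le u v).continuous

lemma eq_of_le_of_mass_le {u v : Lp ℝ 1 μ} (h : u ≤ v) (hm : mass v ≤ mass u) : u = v := by
  have h1 := norm_sub_eq_mass h
  have h2 : ‖v - u‖ ≤ 0 := by linarith
  exact (sub_eq_zero.1 (norm_le_zero_iff.1 h2)).symm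

end Mass

/-! ### Implicit steps and obstacle problems. -/

section ImplicitStep

variable {α : Type*} {mα : MeasurableSpace α} {μ : Measure α} {Φ : Lp ℝ 1 μ → ℝ≥0∞}

/-- Lowering `w` does not decrease the energy. -/
def IsEnergySub (Φ : Lp ℝ 1 μ → ℝ≥0∞) (w : Lp ℝ 1 μ) : Prop := ∀ v, v ≤ w → Φ w ≤ Φ v

/-- `u` is obtained from `w` by an implicit step of size `τ`. -/
def IsImplicitStep (Φ : Lp ℝ 1 μ → ℝ≥0∞) (τ : ℝ) (w u : Lp ℝ 1 μ) : Prop :=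
  ∀ v, Φ u + ENNReal.ofReal (‖u - w‖ ^ 2 / (2 * τ)) ≤ Φ v + ENNReal.ofReal (‖v - w‖ ^ 2 / (2 * τ))

/-- `v` has finite energy and minimizes `Φ + l ∫` above the obstacle `w`. -/
structure SolvesObstacle (Φ : Lp ℝ 1 μ → ℝ≥0∞) (w : Lp ℝ 1 μ) (l : ℝ) (v : Lp ℝ 1 μ) : Prop where
  le : w ≤ v
  lt_top : Φ v < ⊤
  min : ∀ v', w ≤ v' → Φ v' < ⊤ → (Φ v).toReal + l * mass v ≤ (Φ v').toReal + l * mass v'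

namespace IsLatticeEnergy

lemma sup_lt_top (hΦ : IsLatticeEnergy Φ) {u v : Lp ℝ 1 μ} (hu : Φ u < ⊤) (hv : Φ v < ⊤) :
    Φ (u ⊔ v) < ⊤ :=
  (le_self_add.trans (hΦ.submodular u v)).trans_lt (ENNReal.add_lt_top.2 ⟨hu, hv⟩)

lemma inf_lt_top (hΦ : IsLatticeEnergy Φ) {u v : Lp ℝ 1 μ} (hu : Φ u < ⊤) (hv : Φ v < ⊤) :
    Φ (u ⊓ v) < ⊤ :=
  (le_add_self.trans (hΦ.submodular u v)).trans_lt (ENNReal.add_lt_top.2 ⟨hu, hv⟩)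

lemma toReal_submodular (hΦ : IsLatticeEnergy Φ) {u v : Lp ℝ 1 μ} (hu : Φ u < ⊤) (hv : Φ v < ⊤) :
    (Φ (u ⊔ v)).toReal + (Φ (u ⊓ v)).toReal ≤ (Φ u).toReal + (Φ v).toReal := by
  rw [← ENNReal.toReal_add (hΦ.sup_lt_top hu hv).ne (hΦ.inf_lt_top hu hv).ne,
    ← ENNReal.toReal_add hu.ne hv.ne]
  exact ENNReal.toReal_mono (ENNReal.add_lt_top.2 ⟨hu, hv⟩).ne (hΦ.submodular u v)

lemma toReal_convex (hΦ : IsLatticeEnergy Φ) {u v : Lp ℝ 1 μ} (hu : Φ u < ⊤) (hv : Φ v < ⊤)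
    {a b : ℝ} (ha : 0 ≤ a) (hb : 0 ≤ b) (hab : a + b = 1) :
    Φ (a • u + b • v) < ⊤ ∧
      (Φ (a • u + b • v)).toReal ≤ a * (Φ u).toReal + b * (Φ v).toReal := by
  have h := hΦ.convex u v a b ha hb hab
  have hfin : ENNReal.ofReal a * Φ u + ENNReal.ofReal b * Φ v < ⊤ := by finiteness
  refine ⟨h.trans_lt hfin, (ENNReal.toReal_mono hfin.ne h).trans_eq ?_⟩
  rw [ENNReal.toReal_add (by finiteness) (by finiteness), ENNReal.toReal_mul, ENNReal.toReal_mul,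
    ENNReal.toReal_ofReal ha, ENNReal.toReal_ofReal hb]

lemma toReal_strict (hΦ : IsLatticeEnergy Φ) {u v : Lp ℝ 1 μ} (hne : u ≠ v) (hu : Φ u < ⊤)
    (hv : Φ v < ⊤) : (Φ ((2⁻¹ : ℝ) • u + (2⁻¹ : ℝ) • v)).toReal <
      2⁻¹ * (Φ u).toReal + 2⁻¹ * (Φ v).toReal := by
  have h := hΦ.strict u v hne hu hv
  have hfin : ENNReal.ofReal 2⁻¹ * Φ u + ENNReal.ofReal 2⁻¹ * Φ v < ⊤ := by finiteness
  refine (ENNReal.toReal_strict_mono hfin.ne h).trans_eq ?_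
  rw [ENNReal.toReal_add (by finiteness) (by finiteness), ENNReal.toReal_mul, ENNReal.toReal_mul,
    ENNReal.toReal_ofReal (by norm_num)]

end IsLatticeEnergy

namespace IsImplicitStep

variable {τ : ℝ} {w u : Lp ℝ 1 μ}

lemma lt_top (h : IsImplicitStep Φ τ w u) (hw : Φ w < ⊤) : Φ u < ⊤ :=
  (le_self_add.trans (h w)).trans_lt (by finiteness)

lemma toReal_le (h : IsImplicitStep Φ τ w u) (hτ : 0 < τ) (hw : Φ w < ⊤) {v : Lp ℝ 1 μ}
    (hv : Φ v < ⊤) : (Φ u).toReal + ‖u - w‖ ^ 2 / (2 * τ) ≤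
      (Φ v).toReal + ‖v - w‖ ^ 2 / (2 * τ) := by
  have h1 := ENNReal.toReal_mono (by finiteness) (h v)
  rwa [ENNReal.toReal_add (h.lt_top hw).ne (by finiteness),
    ENNReal.toReal_add hv.ne (by finiteness), ENNReal.toReal_ofReal (by positivity),
    ENNReal.toReal_ofReal (by positivity)] at h1

/-- Compare `u` with `u ⊔ w`. Submodularity and `Φ w ≤ Φ (u ⊓ w)` give `Φ (u ⊔ w) ≤ Φ u`, so `u ⊔ w`
cannot be closer to `w` than `u`; in terms of masses this forces `u ⊓ w = w`. -/
lemma le (h : IsImplicitStep Φ τ w u) (hΦ : IsLatticeEnergy Φ) (hτ : 0 < τ) (hw : Φ w < ⊤)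
    (hsub : IsEnergySub Φ w) : w ≤ u := by
  have hu := h.lt_top hw
  have h1 := h.toReal_le hτ hw (hΦ.sup_lt_top hu hw)
  have h2 := hΦ.toReal_submodular hu hw
  have h3 := ENNReal.toReal_mono (hΦ.inf_lt_top hu hw).ne (hsub _ (inf_le_right (a := u)))
  have h4 : ‖u - w‖ ^ 2 ≤ ‖u ⊔ w - w‖ ^ 2 := by
    have : ‖u - w‖ ^ 2 / (2 * τ) ≤ ‖u ⊔ w - w‖ ^ 2 / (2 * τ) := by linarith
    exact (div_le_div_iff_of_pos_right (by positivity)).1 this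
  have h5 := le_of_sq_le_sq h4 (norm_nonneg _)
  rw [norm_sub_eq_mass le_sup_right, norm_sub_eq_mass_sup_inf] at h5
  have h6 : u ⊓ w = w := eq_of_le_of_mass_le inf_le_right (by linarith)
  exact inf_eq_right.1 h6

/-- For `v ≤ u`, the competitor `v ⊔ w` lies between `w` and `u`, hence is no farther from `w` than
`u`, and its energy is at most that of `v`. -/
lemma isEnergySub (h : IsImplicitStep Φ τ w u) (hΦ : IsLatticeEnergy Φ) (hτ : 0 < τ)
    (hw : Φ w < ⊤) (hsub : IsEnergySub Φ w) : IsEnergySub Φ u := by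
  intro v hvu
  rcases (le_top (a := Φ v)).eq_or_lt with hv | hv
  · simp [hv]
  have hu := h.lt_top hw
  have hwu := h.le hΦ hτ hw hsub
  have h1 := h.toReal_le hτ hw (hΦ.sup_lt_top hv hw)
  have h2 := hΦ.toReal_submodular hv hw
  have h3 := ENNReal.toReal_mono (hΦ.inf_lt_top hv hw).ne (hsub _ (inf_le_right (a := v)))
  have h4 : ‖v ⊔ w - w‖ ^ 2 / (2 * τ) ≤ ‖u - w‖ ^ 2 / (2 * τ) := by
    have : ‖v ⊔ w - w‖ ≤ ‖u - w‖ := by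
      rw [norm_sub_eq_mass le_sup_right, norm_sub_eq_mass hwu]
      linarith [mass_mono (sup_le hvu hwu)]
    gcongr
  exact (ENNReal.toReal_le_toReal hu.ne hv.ne).1 (by linarith)

/-- Above `w` the penalty is a smooth function of the mass alone, and its derivative at `u` is the
multiplier. -/
lemma solvesObstacle (h : IsImplicitStep Φ τ w u) (hΦ : IsLatticeEnergy Φ) (hτ : 0 < τ)
    (hw : Φ w < ⊤) (hsub : IsEnergySub Φ w) :
    SolvesObstacle Φ w ((mass u - mass w) / τ) u := by
  have hu := h.lt_top hw
  have hwu := h.le hΦ hτ hw hsub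
  refine ⟨hwu, hu, fun v hwv hv => ?_⟩
  set a := mass u - mass w with ha
  set b := mass v - mass u with hb
  -- Minimality against `(1 - s) u + s v`, with convexity of `Φ`, divided by `s`; then `s → 0`.
  have key : ∀ s : ℝ, 0 < s → s < 1 →
      (Φ u).toReal - (Φ v).toReal ≤ a * b / τ + s * (b ^ 2 / (2 * τ)) := by
    intro s hs hs1
    obtain ⟨hfin, hle⟩ := hΦ.toReal_convex hu hv (a := 1 - s) (b := s) (by linarith) hs.le
      (by ring)
    have hge : w ≤ (1 - s) • u + s • v := by
      have e : w = (1 - s) • w + s • w := by rw [← add_smul]; simp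
      rw [← Lp.coeFn_le]
      filter_upwards [(Lp.coeFn_le _ _).2 hwu, (Lp.coeFn_le _ _).2 hwv,
        Lp.coeFn_add ((1 - s) • u) (s • v), Lp.coeFn_smul (1 - s) u, Lp.coeFn_smul s v]
        with x h1 h2 h3 h4 h5
      rw [h3, Pi.add_apply, h4, h5, Pi.smul_apply, Pi.smul_apply, smul_eq_mul, smul_eq_mul]
      nlinarith
    have h1 := h.toReal_le hτ hw hfin
    rw [norm_sub_eq_mass hwu, norm_sub_eq_mass hge, mass_add, mass_smul, mass_smul, ← ha] at h1
    have e : (1 - s) * mass u + s * mass v - mass w = a + s * b := by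
      rw [ha, hb]
      ring
    rw [e] at h1
    have e2 : (a + s * b) ^ 2 / (2 * τ) =
        a ^ 2 / (2 * τ) + s * (a * b / τ + s * (b ^ 2 / (2 * τ))) := by
      field_simp
      ring
    rw [e2] at h1
    have h2 : s * ((Φ u).toReal - (Φ v).toReal) ≤ s * (a * b / τ + s * (b ^ 2 / (2 * τ))) := by
      linarith
    exact le_of_mul_le_mul_left h2 hs
  have hlim : Tendsto (fun s : ℝ => a * b / τ + s * (b ^ 2 / (2 * τ))) (𝓝[>] 0)
      (𝓝 (a * b / τ)) := by
    have : Tendsto (fun s : ℝ => a * b / τ + s * (b ^ 2 / (2 * τ))) (𝓝 0)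
        (𝓝 (a * b / τ + 0 * (b ^ 2 / (2 * τ)))) := by
      apply Continuous.tendsto
      fun_prop
    rw [zero_mul, add_zero] at this
    exact this.mono_left nhdsWithin_le_nhds
  have hfin := ge_of_tendsto hlim (by
    filter_upwards [Ioo_mem_nhdsGT (zero_lt_one (α := ℝ))] with s hs
    exact key s hs.1 hs.2)
  have e3 : a * b / τ = a / τ * mass v - a / τ * mass u := by
    rw [hb]
    ring
  linarith

end IsImplicitStep

namespace SolvesObstacle

variable {w u v u0 : Lp ℝ 1 μ} {l l' : ℝ}

/-- Solutions of the obstacle problem are ordered like their multipliers. -/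
lemma le_of_lt (hΦ : IsLatticeEnergy Φ) (hu : SolvesObstacle Φ w l u)
    (hv : SolvesObstacle Φ w l' v) (hl : l < l') : v ≤ u := by
  have h1 := hu.min (u ⊔ v) (hu.le.trans le_sup_left) (hΦ.sup_lt_top hu.lt_top hv.lt_top)
  have h2 := hv.min (u ⊓ v) (le_inf hu.le hv.le) (hΦ.inf_lt_top hu.lt_top hv.lt_top)
  have h3 := hΦ.toReal_submodular hu.lt_top hv.lt_top
  have h4 := mass_sup_add_mass_inf u v
  have h5 : mass (u ⊓ v) ≤ mass v := mass_mono inf_le_right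
  -- The two minimality inequalities are added; submodularity cancels the energies.
  have h6 : (l' - l) * (mass v - mass (u ⊓ v)) ≤ 0 := by
    have : mass (u ⊔ v) = mass u + mass v - mass (u ⊓ v) := by linarith
    rw [this] at h1
    nlinarith
  have h7 : mass v ≤ mass (u ⊓ v) := by
    by_contra! hlt
    nlinarith [mul_pos (sub_pos.2 hl) (sub_pos.2 hlt)]
  exact inf_eq_right.1 (eq_of_le_of_mass_le inf_le_right h7)

lemma unique (hΦ : IsLatticeEnergy Φ) (hu : SolvesObstacle Φ w l u)
    (hv : SolvesObstacle Φ w l v) : u = v := by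
  by_contra hne
  have h1 := hΦ.toReal_strict hne hu.lt_top hv.lt_top
  have h2 := (hΦ.toReal_convex hu.lt_top hv.lt_top (a := 2⁻¹) (b := 2⁻¹) (by norm_num)
    (by norm_num) (by norm_num)).1
  have hge : w ≤ (2⁻¹ : ℝ) • u + (2⁻¹ : ℝ) • v := by
    rw [← Lp.coeFn_le]
    filter_upwards [(Lp.coeFn_le _ _).2 hu.le, (Lp.coeFn_le _ _).2 hv.le,
      Lp.coeFn_add ((2⁻¹ : ℝ) • u) ((2⁻¹ : ℝ) • v), Lp.coeFn_smul (2⁻¹ : ℝ) u,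
      Lp.coeFn_smul (2⁻¹ : ℝ) v] with x h1 h2 h3 h4 h5
    rw [h3, Pi.add_apply, h4, h5, Pi.smul_apply, Pi.smul_apply, smul_eq_mul, smul_eq_mul]
    linarith
  have h3 := hu.min _ hge h2
  have h4 := hv.min _ hge h2
  rw [mass_add, mass_smul, mass_smul] at h3 h4
  linarith

lemma le_total (hΦ : IsLatticeEnergy Φ) (hu : SolvesObstacle Φ w l u)
    (hv : SolvesObstacle Φ w l' v) : u ≤ v ∨ v ≤ u := by
  rcases lt_trichotomy l l' with h | rfl | h
  · exact Or.inr (hu.le_of_lt hΦ hv h)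
  · exact Or.inl (hu.unique hΦ hv).le
  · exact Or.inl (hv.le_of_lt hΦ hu h)

/-- Adding the two minimality inequalities gives `(l' - l) (mass v - mass u) ≤ 0`. -/
lemma multiplier_le (hu : SolvesObstacle Φ w l u) (hv : SolvesObstacle Φ w l' v)
    (h : mass u < mass v) : l' ≤ l := by
  have h1 := hu.min v hv.le hv.lt_top
  have h2 := hv.min u hu.le hu.lt_top
  by_contra! hlt
  nlinarith [mul_pos (sub_pos.2 hlt) (sub_pos.2 h)]

/-- Solving the obstacle problem above a solution with a larger multiplier is the same as solving
it above the original obstacle. -/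
lemma trans (hΦ : IsLatticeEnergy Φ) (hw : SolvesObstacle Φ u0 l w)
    (hu : SolvesObstacle Φ w l' u) (hl : l' ≤ l) : SolvesObstacle Φ u0 l' u := by
  refine ⟨hw.le.trans hu.le, hu.lt_top, fun v h0v hv => ?_⟩
  -- A competitor `v` above `u0` splits into `v ⊔ w`, admissible for `u`, and `v ⊓ w`, admissible
  -- for `w`.
  have h1 := hu.min (v ⊔ w) le_sup_right (hΦ.sup_lt_top hv hw.lt_top)
  have h2 := hw.min (v ⊓ w) (le_inf h0v hw.le) (hΦ.inf_lt_top hv hw.lt_top)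
  have h3 := hΦ.toReal_submodular hv hw.lt_top
  have h4 := mass_sup_add_mass_inf v w
  have h5 : mass (v ⊓ w) ≤ mass w := mass_mono inf_le_right
  have h6 : l' * (mass w - mass (v ⊓ w)) ≤ l * (mass w - mass (v ⊓ w)) :=
    mul_le_mul_of_nonneg_right hl (by linarith)
  have h7 : mass (v ⊔ w) = mass v + mass w - mass (v ⊓ w) := by linarith
  rw [h7] at h1
  linarith

end SolvesObstacle

end ImplicitStep

/-! ### Scalar Euler schemes: Hölder bound, comparison, square integrability. -/

/-- A scalar implicit Euler scheme with non-increasing speeds `l n ≥ 0`, whose action is bounded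
by `C ^ 2`. -/
structure EulerScheme (C τ : ℝ) (m l : ℕ → ℝ) : Prop where
  const_nonneg : 0 ≤ C
  pos : 0 < τ
  step : ∀ n, m (n + 1) = m n + τ * l n
  anti : Antitone l
  nonneg : ∀ n, 0 ≤ l n
  action : ∀ n, ∑ i ∈ Finset.range n, τ * l i ^ 2 ≤ C ^ 2

namespace EulerScheme

variable {C τ σ : ℝ} {m l m' l' : ℕ → ℝ}

lemma mono (h : EulerScheme C τ m l) : Monotone m :=
  monotone_nat_of_le_succ fun n => by
    rw [h.step n]
    exact le_add_of_nonneg_right (mul_nonneg h.pos.le (h.nonneg n))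

lemma sub_eq_sum (h : EulerScheme C τ m l) {k n : ℕ} (hkn : k ≤ n) :
    m n - m k = ∑ i ∈ Finset.Ico k n, τ * l i := by
  rw [← Finset.sum_Ico_sub m hkn]
  refine Finset.sum_congr rfl fun i _ => ?_
  rw [h.step i]
  ring

lemma sub_le (h : EulerScheme C τ m l) {k n : ℕ} (hkn : k ≤ n) :
    m n - m k ≤ C * √(τ * (n - k)) := by
  have hnk : (0 : ℝ) ≤ n - k := sub_nonneg.2 (Nat.cast_le.2 hkn)
  have h1 : (m n - m k) ^ 2 ≤ C ^ 2 * (τ * (n - k)) := by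
    rw [h.sub_eq_sum hkn]
    refine sq_sum_le_card_mul_sum_sq.trans ?_
    have h2 : ∑ i ∈ Finset.Ico k n, τ * l i ^ 2 ≤ C ^ 2 := by
      refine (Finset.sum_le_sum_of_subset_of_nonneg ?_ fun i _ _ => ?_).trans (h.action n)
      · intro i hi
        exact Finset.mem_range.2 (Finset.mem_Ico.1 hi).2
      · exact mul_nonneg h.pos.le (sq_nonneg _)
    have h3 : ∑ i ∈ Finset.Ico k n, (τ * l i) ^ 2 = τ * ∑ i ∈ Finset.Ico k n, τ * l i ^ 2 := by
      rw [Finset.mul_sum]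
      exact Finset.sum_congr rfl fun i _ => by ring
    rw [h3, Nat.card_Ico, Nat.cast_sub hkn]
    calc ((n : ℝ) - k) * (τ * ∑ i ∈ Finset.Ico k n, τ * l i ^ 2)
        ≤ (n - k) * (τ * C ^ 2) := by
          have := h.pos
          gcongr
      _ = C ^ 2 * (τ * (n - k)) := by ring
  refine (Real.le_sqrt_of_sq_le h1).trans_eq ?_
  rw [Real.sqrt_mul (sq_nonneg C), Real.sqrt_sq h.const_nonneg]

lemma succ_sub_le (h : EulerScheme C τ m l) (n : ℕ) : m (n + 1) ≤ m n + C * √τ := by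
  have := h.sub_le (Nat.le_succ n)
  rw [Nat.succ_eq_add_one, Nat.cast_add, Nat.cast_one, add_sub_cancel_left, mul_one] at this
  linarith

/-- The piecewise affine interpolation of a scheme. -/
noncomputable def interp (τ : ℝ) (m l : ℕ → ℝ) (t : ℝ) : ℝ :=
  m ⌊t / τ⌋₊ + (t - ⌊t / τ⌋₊ * τ) * l ⌊t / τ⌋₊

lemma floor_mul_le (hτ : 0 < τ) {t : ℝ} (ht : 0 ≤ t) : ⌊t / τ⌋₊ * τ ≤ t :=
  (le_div_iff₀ hτ).1 (Nat.floor_le (by positivity))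

lemma lt_floor_add_one_mul (hτ : 0 < τ) (t : ℝ) : t < (⌊t / τ⌋₊ + 1) * τ :=
  (div_lt_iff₀ hτ).1 (Nat.lt_floor_add_one _)

lemma interp_le (h : EulerScheme C τ m l) (t : ℝ) : interp τ m l t ≤ m (⌊t / τ⌋₊ + 1) := by
  rw [interp, h.step]
  have h1 := lt_floor_add_one_mul h.pos t
  have h2 := h.nonneg ⌊t / τ⌋₊
  nlinarith

lemma le_interp (h : EulerScheme C τ m l) {t : ℝ} (ht : 0 ≤ t) : m ⌊t / τ⌋₊ ≤ interp τ m l t :=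
  le_add_of_nonneg_right (mul_nonneg (sub_nonneg.2 (floor_mul_le h.pos ht)) (h.nonneg _))

lemma mul_le_sub (h : EulerScheme C τ m l) {c : ℝ} {j k : ℕ} (hjk : j ≤ k)
    (hc : ∀ p < k, c ≤ l p) : c * (τ * (k - j)) ≤ m k - m j := by
  induction k, hjk using Nat.le_induction with
  | base => simp
  | succ k hk ih =>
    have h1 := ih fun p hp => hc p (hp.trans k.lt_succ_self)
    have h2 := mul_le_mul_of_nonneg_left (hc k k.lt_succ_self) h.pos.le
    rw [h.step]
    push_cast
    linarith

/-- If both times lie in one cell this is a single affine piece; otherwise the increment is the rest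
of the first cell, the full cells, and the start of the last. -/
lemma slope_le (h : EulerScheme C τ m l) {c s t : ℝ} (hs : 0 ≤ s) (hst : s ≤ t)
    (hc : ∀ p ≤ ⌊t / τ⌋₊, c ≤ l p) : c * (t - s) ≤ interp τ m l t - interp τ m l s := by
  have ht := hs.trans hst
  have hpq : ⌊s / τ⌋₊ ≤ ⌊t / τ⌋₊ := Nat.floor_mono (by have := h.pos; gcongr)
  have hq1 := floor_mul_le h.pos ht
  have hp2 := lt_floor_add_one_mul h.pos s
  unfold interp
  rcases hpq.eq_or_lt with heq | hlt
  · rw [heq]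
    have := mul_le_mul_of_nonneg_right (hc _ le_rfl) (sub_nonneg.2 hst)
    linarith
  · have h1 := h.mul_le_sub (Nat.succ_le_of_lt hlt) fun p hp => hc p hp.le
    have h2 := mul_le_mul_of_nonneg_right (hc _ le_rfl) (sub_nonneg.2 hq1)
    have h3 := mul_le_mul_of_nonneg_right (hc _ hpq) (sub_nonneg.2 hp2.le)
    rw [Nat.succ_eq_add_one, h.step] at h1
    push_cast at h1
    linarith

lemma interp_mono (h : EulerScheme C τ m l) {s t : ℝ} (hs : 0 ≤ s) (hst : s ≤ t) :
    interp τ m l s ≤ interp τ m l t := by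
  have := h.slope_le (c := 0) hs hst fun p _ => h.nonneg p
  linarith

/-- Induction on `i`. Either `m (i + 1)` is at most the next value of the other scheme, which
exceeds its interpolant by at most `C √σ`; or the other scheme is still behind, and then by `hcomp`
all its speeds so far are at least `l i`, so the excess does not grow over this step. -/
lemma le_interp_add (h : EulerScheme C τ m l) (h' : EulerScheme C σ m' l') (h0 : m 0 = m' 0)
    (hcomp : ∀ i j, m' (j + 1) < m (i + 1) → l i ≤ l' j) (i : ℕ) :
    m i ≤ interp σ m' l' (i * τ) + C * √σ := by
  induction i with
  | zero =>
    have := mul_nonneg h.const_nonneg (Real.sqrt_nonneg σ)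
    simpa [interp, h0] using this
  | succ i ih =>
    have hτ := h.pos
    have ht : (0 : ℝ) ≤ ((i + 1 : ℕ) : ℝ) * τ := by positivity
    rcases le_or_gt (m (i + 1)) (m' (⌊((i + 1 : ℕ) : ℝ) * τ / σ⌋₊ + 1)) with hle | hlt
    · have h1 := h'.succ_sub_le ⌊((i + 1 : ℕ) : ℝ) * τ / σ⌋₊
      have h2 := h'.le_interp ht
      linarith
    · have h1 := h'.slope_le (c := l i) (s := i * τ) (t := ((i + 1 : ℕ) : ℝ) * τ) (by positivity)
        (by push_cast; linarith) fun p hp => hcomp i p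
          ((h'.mono (Nat.add_le_add_right hp 1)).trans_lt hlt)
      rw [h.step]
      push_cast at h1 ⊢
      linarith

lemma apply_floor_le (h : EulerScheme C τ m l) (h' : EulerScheme C σ m' l') (h0 : m 0 = m' 0)
    (hcomp : ∀ i j, m' (j + 1) < m (i + 1) → l i ≤ l' j) {t : ℝ} (ht : 0 ≤ t) :
    m ⌊t / τ⌋₊ ≤ m' ⌊t / σ⌋₊ + 2 * (C * √σ) := by
  have h1 := h.le_interp_add h' h0 hcomp ⌊t / τ⌋₊
  have h2 := h'.interp_mono (by have := h.pos; positivity) (floor_mul_le h.pos ht)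
  have h3 := h'.interp_le t
  have h4 := h'.succ_sub_le ⌊t / σ⌋₊
  linarith

/-- The natural subtraction makes the cells `0` and `1` both use `l 0`; the repeated term is bounded
by the action once more, whence the factor `2`. -/
lemma lintegral_sq_le (h : EulerScheme C τ m l) :
    ∫⁻ t in Ioi (0 : ℝ), ENNReal.ofReal (l (⌊t / τ⌋₊ - 1) ^ 2) ≤ ENNReal.ofReal (2 * C ^ 2) := by
  have hτ := h.pos
  have hsub : Ioi (0 : ℝ) ⊆ ⋃ n : ℕ, Ico (n * τ) ((n + 1) * τ) := fun t ht =>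
    mem_iUnion.2 ⟨⌊t / τ⌋₊, floor_mul_le h.pos (le_of_lt ht), lt_floor_add_one_mul h.pos t⟩
  have hn : ∀ n : ℕ, ∫⁻ t in Ico (n * τ) ((n + 1) * τ), ENNReal.ofReal (l (⌊t / τ⌋₊ - 1) ^ 2) =
      ENNReal.ofReal (τ * l (n - 1) ^ 2) := by
    intro n
    have h1 : ∀ t ∈ Ico (n * τ) ((n + 1) * τ), ENNReal.ofReal (l (⌊t / τ⌋₊ - 1) ^ 2) =
        ENNReal.ofReal (l (n - 1) ^ 2) := by
      intro t ht
      have : ⌊t / τ⌋₊ = n := by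
        have hn0 : (0 : ℝ) ≤ n * τ := by positivity
        rw [Nat.floor_eq_iff (div_nonneg (hn0.trans ht.1) hτ.le)]
        exact ⟨(le_div_iff₀ hτ).2 ht.1, (div_lt_iff₀ hτ).2 ht.2⟩
      rw [this]
    rw [setLIntegral_congr_fun measurableSet_Ico h1, setLIntegral_const, Real.volume_Ico,
      ← ENNReal.ofReal_mul (sq_nonneg _)]
    congr 1
    ring
  calc ∫⁻ t in Ioi (0 : ℝ), ENNReal.ofReal (l (⌊t / τ⌋₊ - 1) ^ 2)
      ≤ ∫⁻ t in ⋃ n : ℕ, Ico (n * τ) ((n + 1) * τ), ENNReal.ofReal (l (⌊t / τ⌋₊ - 1) ^ 2) :=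
        lintegral_mono_set hsub
    _ ≤ ∑' n : ℕ, ∫⁻ t in Ico (n * τ) ((n + 1) * τ), ENNReal.ofReal (l (⌊t / τ⌋₊ - 1) ^ 2) :=
        lintegral_iUnion_le _ _
    _ = ∑' n : ℕ, ENNReal.ofReal (τ * l (n - 1) ^ 2) := by simp only [hn]
    _ ≤ ENNReal.ofReal (2 * C ^ 2) := by
        refine ENNReal.tsum_le_of_sum_range_le fun n => ?_
        rw [← ENNReal.ofReal_sum_of_nonneg fun i _ => by positivity]
        refine ENNReal.ofReal_le_ofReal ?_
        refine (Finset.sum_le_sum_of_subset_of_nonneg (Finset.range_mono n.le_succ)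
          fun i _ _ => by positivity).trans ?_
        rw [Finset.sum_range_succ']
        have h1 := h.action n
        have h2 := h.action 1
        simp only [Finset.sum_range_one] at h2
        simp only [Nat.add_sub_cancel, Nat.zero_sub]
        linarith

end EulerScheme

/-! ### Movements, their comparison and convergence. -/

section Movement

variable {α : Type*} {mα : MeasurableSpace α} {μ : Measure α} {Φ : Lp ℝ 1 μ → ℝ≥0∞}
  {u0 : Lp ℝ 1 μ} {τ σ : ℝ} {U V : ℕ → Lp ℝ 1 μ}

/-- A sequence of implicit steps of size `τ > 0`, for a lattice energy, which starts at a
subsolution of finite energy. -/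
structure IsMovement (Φ : Lp ℝ 1 μ → ℝ≥0∞) (u0 : Lp ℝ 1 μ) (τ : ℝ) (U : ℕ → Lp ℝ 1 μ) : Prop where
  energy : IsLatticeEnergy Φ
  sub : IsEnergySub Φ u0
  lt_top : Φ u0 < ⊤
  pos : 0 < τ
  zero : U 0 = u0
  step : ∀ n, IsImplicitStep Φ τ (U n) (U (n + 1))

lemma exists_isMovement (hΦ : IsLatticeEnergy Φ) (hsub : IsEnergySub Φ u0) (hfin : Φ u0 < ⊤)
    (hτ : 0 < τ) : ∃ U, IsMovement Φ u0 τ U := by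
  choose f hf using fun w => hΦ.exists_step w τ hτ
  exact ⟨fun n => f^[n] u0, hΦ, hsub, hfin, hτ, rfl, fun n => by
    simp only [Function.iterate_succ_apply']
    exact hf _⟩

/-- The speeds of a movement. -/
noncomputable def speed (τ : ℝ) (U : ℕ → Lp ℝ 1 μ) (n : ℕ) : ℝ := (mass (U (n + 1)) - mass (U n)) / τ

namespace IsMovement

lemma sub_and_lt_top (h : IsMovement Φ u0 τ U) (n : ℕ) : IsEnergySub Φ (U n) ∧ Φ (U n) < ⊤ := by
  induction n with
  | zero => exact h.zero.symm ▸ ⟨h.sub, h.lt_top⟩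
  | succ n ih =>
    exact ⟨(h.step n).isEnergySub h.energy h.pos ih.2 ih.1, (h.step n).lt_top ih.2⟩

lemma mono (h : IsMovement Φ u0 τ U) : Monotone U :=
  monotone_nat_of_le_succ fun n =>
    (h.step n).le h.energy h.pos (h.sub_and_lt_top n).2 (h.sub_and_lt_top n).1

lemma speed_nonneg (h : IsMovement Φ u0 τ U) (n : ℕ) : 0 ≤ speed τ U n :=
  div_nonneg (sub_nonneg.2 (mass_mono (h.mono n.le_succ))) h.pos.le

lemma mass_succ (h : IsMovement Φ u0 τ U) (n : ℕ) :
    mass (U (n + 1)) = mass (U n) + τ * speed τ U n := by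
  rw [speed, mul_div_cancel₀ _ h.pos.ne']
  ring

lemma solvesObstacle_step (h : IsMovement Φ u0 τ U) (n : ℕ) :
    SolvesObstacle Φ (U n) (speed τ U n) (U (n + 1)) :=
  (h.step n).solvesObstacle h.energy h.pos (h.sub_and_lt_top n).2 (h.sub_and_lt_top n).1

/-- If the mass does not grow the next speed is `0`. Otherwise compare `U (n + 1)` with `U (n + 2)`
in the problem above `U n`, and conversely in the problem above `U (n + 1)`, and add. -/
lemma speed_antitone (h : IsMovement Φ u0 τ U) : Antitone (speed τ U) := by
  refine antitone_nat_of_succ_le fun n => ?_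
  rcases (mass_mono (h.mono (n + 1).le_succ)).eq_or_lt with heq | hlt
  · have : speed τ U (n + 1) = 0 := by
      rw [speed, ← heq]
      simp
    rw [this]
    exact h.speed_nonneg n
  · have h1 := (h.solvesObstacle_step n).min _ (h.mono (show n ≤ n + 1 + 1 by omega))
      (h.sub_and_lt_top _).2
    have h2 := (h.solvesObstacle_step (n + 1)).min _ le_rfl (h.sub_and_lt_top _).2
    by_contra! hlt'
    nlinarith [mul_pos (sub_pos.2 hlt') (sub_pos.2 hlt)]

lemma solvesObstacle (h : IsMovement Φ u0 τ U) (n : ℕ) :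
    SolvesObstacle Φ u0 (speed τ U n) (U (n + 1)) := by
  induction n with
  | zero => exact h.zero ▸ h.solvesObstacle_step 0
  | succ n ih => exact ih.trans h.energy (h.solvesObstacle_step (n + 1)) (h.speed_antitone n.le_succ)

/-- The step is compared with not moving at all. Summed over `n`, this bounds the action by `2
Φ(u0)`. -/
lemma energy_succ (h : IsMovement Φ u0 τ U) (n : ℕ) :
    2 * (Φ (U (n + 1))).toReal + τ * speed τ U n ^ 2 ≤ 2 * (Φ (U n)).toReal := by
  have h1 := (h.step n).toReal_le h.pos (h.sub_and_lt_top n).2 (h.sub_and_lt_top n).2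
  have hτ := h.pos
  rw [sub_self, norm_zero, norm_sub_eq_mass (h.mono n.le_succ), h.mass_succ] at h1
  have e : (mass (U n) + τ * speed τ U n - mass (U n)) ^ 2 / (2 * τ) =
      τ * speed τ U n ^ 2 / 2 := by
    field_simp
    ring
  rw [e] at h1
  norm_num at h1
  linarith

lemma eulerScheme (h : IsMovement Φ u0 τ U) :
    EulerScheme (√(2 * (Φ u0).toReal)) τ (fun n => mass (U n)) (speed τ U) where
  const_nonneg := Real.sqrt_nonneg _
  pos := h.pos
  step := h.mass_succ
  anti := h.speed_antitone
  nonneg := h.speed_nonneg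
  action := fun n => by
    rw [Real.sq_sqrt (by positivity)]
    have key : 2 * (Φ (U n)).toReal + ∑ i ∈ Finset.range n, τ * speed τ U i ^ 2 ≤
        2 * (Φ u0).toReal := by
      induction n with
      | zero => simp [h.zero]
      | succ n ih =>
        rw [Finset.sum_range_succ]
        linarith [h.energy_succ n]
    have : 0 ≤ (Φ (U n)).toReal := ENNReal.toReal_nonneg
    linarith

lemma le_total (h : IsMovement Φ u0 τ U) (h' : IsMovement Φ u0 σ V) (i j : ℕ) :
    U i ≤ V j ∨ V j ≤ U i := by
  rcases i with _ | i
  · exact Or.inl (h.zero.trans h'.zero.symm ▸ h'.mono j.zero_le)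
  rcases j with _ | j
  · exact Or.inr (h'.zero.trans h.zero.symm ▸ h.mono (i + 1).zero_le)
  exact (h.solvesObstacle i).le_total h.energy (h'.solvesObstacle j)

/-- Two movements with the same initial datum are close if their time steps are small. -/
lemma norm_sub_le (h : IsMovement Φ u0 τ U) (h' : IsMovement Φ u0 σ V) {t : ℝ} (ht : 0 ≤ t) :
    ‖U ⌊t / τ⌋₊ - V ⌊t / σ⌋₊‖ ≤ 2 * (√(2 * (Φ u0).toReal) * (√τ + √σ)) := by
  have hC : 0 ≤ √(2 * (Φ u0).toReal) := Real.sqrt_nonneg _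
  -- The comparison hypothesis of the schemes is the monotonicity of multipliers in the mass. It is
  -- used both ways, and since the states are ordered the mass bounds are norm bounds.
  have h1 := h.eulerScheme.apply_floor_le h'.eulerScheme (by simp only [h.zero, h'.zero])
    (fun i j hlt => (h'.solvesObstacle j).multiplier_le (h.solvesObstacle i) hlt) ht
  have h2 := h'.eulerScheme.apply_floor_le h.eulerScheme (by simp only [h.zero, h'.zero])
    (fun i j hlt => (h.solvesObstacle j).multiplier_le (h'.solvesObstacle i) hlt) ht
  have h3 := mul_nonneg hC (Real.sqrt_nonneg τ)
  have h4 := mul_nonneg hC (Real.sqrt_nonneg σ)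
  rcases h.le_total h' ⌊t / τ⌋₊ ⌊t / σ⌋₊ with hle | hle
  · rw [norm_sub_rev, norm_sub_eq_mass hle]
    linarith
  · rw [norm_sub_eq_mass hle]
    linarith

lemma norm_apply_sub_apply_le (h : IsMovement Φ u0 τ U) {s t : ℝ} (hs : 0 ≤ s) (hst : s ≤ t) :
    ‖U ⌊t / τ⌋₊ - U ⌊s / τ⌋₊‖ ≤ √(2 * (Φ u0).toReal) * √(t - s + τ) := by
  have hτ := h.pos
  have hle : ⌊s / τ⌋₊ ≤ ⌊t / τ⌋₊ := Nat.floor_mono (by gcongr)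
  rw [norm_sub_eq_mass (h.mono hle)]
  refine (h.eulerScheme.sub_le hle).trans ?_
  gcongr
  have h1 := EulerScheme.floor_mul_le h.pos (hs.trans hst)
  have h2 := EulerScheme.lt_floor_add_one_mul h.pos s
  linarith

/-- The first `n` speeds are at least the last of them, so `n τ l² ≤ 2 Φ(u0)`, and `n τ ≥ t - τ ≥ t
/ 2`. -/
lemma sq_speed_le (hU : IsMovement Φ u0 τ U) {t : ℝ} (ht : 0 < t) (hτ : 2 * τ ≤ t) :
    speed τ U (⌊t / τ⌋₊ - 1) ^ 2 ≤ 4 * (Φ u0).toReal / t := by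
  set n := ⌊t / τ⌋₊ with hn
  have h1 := hU.eulerScheme.action n
  rw [Real.sq_sqrt (by positivity)] at h1
  have h2 : ∑ i ∈ Finset.range n, τ * speed τ U (n - 1) ^ 2 ≤
      ∑ i ∈ Finset.range n, τ * speed τ U i ^ 2 := by
    refine Finset.sum_le_sum fun i hi => ?_
    have h3 := hU.speed_antitone (show i ≤ n - 1 by have := Finset.mem_range.1 hi; omega)
    have h4 := hU.speed_nonneg (n - 1)
    have h5 := hU.pos
    gcongr
  rw [Finset.sum_const, Finset.card_range, nsmul_eq_mul] at h2
  have h6 := EulerScheme.lt_floor_add_one_mul hU.pos t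
  rw [← hn] at h6
  rw [le_div_iff₀ ht]
  nlinarith [sq_nonneg (speed τ U (n - 1))]

end IsMovement

/-- The minimizing movements converge, as the time step goes to zero. -/
lemma exists_limit (hΦ : IsLatticeEnergy Φ) (hsub : IsEnergySub Φ u0) (hfin : Φ u0 < ⊤) :
    ∃ u : ℝ≥0 → Lp ℝ 1 μ, ∀ (τ : ℝ) (U : ℕ → Lp ℝ 1 μ), IsMovement Φ u0 τ U →
      ∀ t : ℝ≥0, ‖U ⌊(t : ℝ) / τ⌋₊ - u t‖ ≤ 2 * (√(2 * (Φ u0).toReal) * √τ) := by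
  have hpos : ∀ k : ℕ, (0 : ℝ) < 1 / ((k : ℝ) + 1) := fun k => by positivity
  choose V hV using fun k => exists_isMovement hΦ hsub hfin (hpos k)
  set C := √(2 * (Φ u0).toReal) with hC
  have hC0 : 0 ≤ C := Real.sqrt_nonneg _
  have hsq : Tendsto (fun k : ℕ => √(1 / ((k : ℝ) + 1))) atTop (𝓝 0) := by
    simpa using (tendsto_one_div_add_atTop_nhds_zero_nat (𝕜 := ℝ)).sqrt
  have hcau : ∀ t : ℝ≥0, CauchySeq fun k => V k ⌊(t : ℝ) / (1 / ((k : ℝ) + 1))⌋₊ := by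
    intro t
    refine cauchySeq_of_le_tendsto_0 (fun N : ℕ => 2 * (C * (√(1 / ((N : ℝ) + 1)) +
      √(1 / ((N : ℝ) + 1))))) (fun n k N hn hk => ?_) ?_
    · rw [dist_eq_norm]
      refine ((hV n).norm_sub_le (hV k) t.2).trans ?_
      gcongr
    · simpa using ((hsq.add hsq).const_mul C).const_mul 2
  choose u hu using fun t => cauchySeq_tendsto_of_complete (hcau t)
  refine ⟨u, fun τ U hU t => ?_⟩
  have h1 : Tendsto (fun k => ‖U ⌊(t : ℝ) / τ⌋₊ - V k ⌊(t : ℝ) / (1 / ((k : ℝ) + 1))⌋₊‖) atTop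
      (𝓝 ‖U ⌊(t : ℝ) / τ⌋₊ - u t‖) := ((hu t).const_sub _).norm
  have h2 : Tendsto (fun k : ℕ => 2 * (C * (√τ + √(1 / ((k : ℝ) + 1))))) atTop
      (𝓝 (2 * (C * (√τ + 0)))) := ((hsq.const_add _).const_mul C).const_mul 2
  rw [add_zero] at h2
  exact le_of_tendsto_of_tendsto' h1 h2 fun k => hU.norm_sub_le (hV k) t.2

/-- The obstacle problem is stable. -/
lemma SolvesObstacle.of_tendsto (hΦ : IsLatticeEnergy Φ) (hfin : Φ u0 < ⊤) {l : ℕ → ℝ} {l' : ℝ}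
    {v : ℕ → Lp ℝ 1 μ} {v' : Lp ℝ 1 μ} (h : ∀ᶠ k in atTop, SolvesObstacle Φ u0 (l k) (v k))
    (hl : Tendsto l atTop (𝓝 l')) (hv : Tendsto v atTop (𝓝 v')) : SolvesObstacle Φ u0 l' v' := by
  have hm : Tendsto (fun k => mass (v k)) atTop (𝓝 (mass v')) := (continuous_mass.tendsto _).comp hv
  have key : ∀ w, u0 ≤ w → Φ w < ⊤ → Φ v' < ⊤ ∧
      (Φ v').toReal ≤ (Φ w).toReal + l' * (mass w - mass v') := by
    intro w hw hwfin
    have hr : Tendsto (fun k => (Φ w).toReal + l k * (mass w - mass (v k))) atTop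
        (𝓝 ((Φ w).toReal + l' * (mass w - mass v'))) :=
      (hl.mul (hm.const_sub _)).const_add _
    have hle : ∀ᶠ k in atTop, (Φ (v k)).toReal ≤ (Φ w).toReal + l k * (mass w - mass (v k)) :=
      h.mono fun k hk => by linarith [hk.min w hw hwfin]
    have hr0 : 0 ≤ (Φ w).toReal + l' * (mass w - mass v') :=
      ge_of_tendsto hr (hle.mono fun k hk => ENNReal.toReal_nonneg.trans hk)
    -- The energies need not converge; they are eventually below the limit of the right-hand sides
    -- plus `ε`, and the sublevel is closed.
    have hε : ∀ ε > 0, Φ v' ≤ ENNReal.ofReal ((Φ w).toReal + l' * (mass w - mass v') + ε) := by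
      intro ε hε
      refine (hΦ.isClosed _ ENNReal.ofReal_lt_top).mem_of_tendsto hv ?_
      filter_upwards [h, hle, hr.eventually (gt_mem_nhds (lt_add_of_pos_right _ hε))]
        with k h1 h2 h3
      exact (ENNReal.le_ofReal_iff_toReal_le h1.lt_top.ne (by linarith)).2 (h2.trans h3.le)
    exact ⟨(hε 1 one_pos).trans_lt ENNReal.ofReal_lt_top, le_of_forall_pos_le_add fun ε hε' =>
      ENNReal.toReal_le_of_le_ofReal (by linarith) (hε ε hε')⟩
  refine ⟨ge_of_tendsto hv (h.mono fun k hk => hk.le), (key u0 le_rfl hfin).1, fun w hw hwf => ?_⟩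
  linarith [(key w hw hwf).2]

end Movement

/-! ### Properties of the limit and of its multiplier. -/

section Limit

variable {α : Type*} {mα : MeasurableSpace α} {μ : Measure α} {Φ : Lp ℝ 1 μ → ℝ≥0∞}
  {u0 : Lp ℝ 1 μ} {u : ℝ≥0 → Lp ℝ 1 μ}

/-- The movements with initial datum `u0` converge to `u` as the time step goes to zero. -/
structure IsMovementLimit (Φ : Lp ℝ 1 μ → ℝ≥0∞) (u0 : Lp ℝ 1 μ) (u : ℝ≥0 → Lp ℝ 1 μ) :
    Prop where
  energy : IsLatticeEnergy Φ
  sub : IsEnergySub Φ u0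
  lt_top : Φ u0 < ⊤
  norm_sub_le : ∀ (τ : ℝ) (U : ℕ → Lp ℝ 1 μ), IsMovement Φ u0 τ U →
    ∀ t : ℝ≥0, ‖U ⌊(t : ℝ) / τ⌋₊ - u t‖ ≤ 2 * (√(2 * (Φ u0).toReal) * √τ)

/-- The smallest multiplier for which `v` solves the obstacle problem. -/
noncomputable def minMultiplier (Φ : Lp ℝ 1 μ → ℝ≥0∞) (u0 v : Lp ℝ 1 μ) : ℝ :=
  sInf {l | 0 ≤ l ∧ SolvesObstacle Φ u0 l v}

lemma minMultiplier_nonneg (v : Lp ℝ 1 μ) : 0 ≤ minMultiplier Φ u0 v :=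
  Real.sInf_nonneg fun _ h => h.1

lemma minMultiplier_le {v : Lp ℝ 1 μ} {l : ℝ} (hl : 0 ≤ l) (h : SolvesObstacle Φ u0 l v) :
    minMultiplier Φ u0 v ≤ l :=
  csInf_le ⟨0, fun _ h => h.1⟩ ⟨hl, h⟩

lemma solvesObstacle_minMultiplier (hΦ : IsLatticeEnergy Φ) (hfin : Φ u0 < ⊤) {v : Lp ℝ 1 μ}
    (h : ∃ l, 0 ≤ l ∧ SolvesObstacle Φ u0 l v) :
    SolvesObstacle Φ u0 (minMultiplier Φ u0 v) v := by
  obtain ⟨l, -, hl, hmem⟩ := exists_seq_tendsto_sInf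
    (S := {l | 0 ≤ l ∧ SolvesObstacle Φ u0 l v}) h ⟨0, fun _ h => h.1⟩
  exact SolvesObstacle.of_tendsto hΦ hfin (Eventually.of_forall fun k => (hmem k).2) hl
    tendsto_const_nhds

namespace IsMovementLimit

lemma tendsto (h : IsMovementLimit Φ u0 u) {τ : ℕ → ℝ} {U : ℕ → ℕ → Lp ℝ 1 μ}
    (hU : ∀ k, IsMovement Φ u0 (τ k) (U k)) (hτ : Tendsto τ atTop (𝓝 0)) (t : ℝ≥0) :
    Tendsto (fun k => U k ⌊(t : ℝ) / τ k⌋₊) atTop (𝓝 (u t)) := by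
  rw [tendsto_iff_norm_sub_tendsto_zero]
  refine squeeze_zero (fun _ => norm_nonneg _) (fun k => h.norm_sub_le _ _ (hU k) t) ?_
  simpa using (hτ.sqrt.const_mul (√(2 * (Φ u0).toReal))).const_mul 2

lemma exists_movements (h : IsMovementLimit Φ u0 u) :
    ∃ (τ : ℕ → ℝ) (U : ℕ → ℕ → Lp ℝ 1 μ), (∀ k, IsMovement Φ u0 (τ k) (U k)) ∧
      Tendsto τ atTop (𝓝 0) := by
  choose U hU using fun k : ℕ => exists_isMovement h.energy h.sub h.lt_top
    (show (0 : ℝ) < 1 / ((k : ℝ) + 1) by positivity)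
  exact ⟨_, U, hU, tendsto_one_div_add_atTop_nhds_zero_nat⟩

lemma tendstoUniformlyOn (h : IsMovementLimit Φ u0 u) {τ : ℕ → ℝ} {U : ℕ → ℕ → Lp ℝ 1 μ}
    (hU : ∀ k, IsMovement Φ u0 (τ k) (U k)) (hτ : Tendsto τ atTop (𝓝 0)) (s : Set ℝ≥0) :
    TendstoUniformlyOn (fun (k : ℕ) (t : ℝ≥0) => U k ⌊(t : ℝ) / τ k⌋₊) u atTop s := by
  rw [Metric.tendstoUniformlyOn_iff]
  intro ε hε
  have h1 : Tendsto (fun k => 2 * (√(2 * (Φ u0).toReal) * √(τ k))) atTop (𝓝 0) := by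
    simpa using (hτ.sqrt.const_mul (√(2 * (Φ u0).toReal))).const_mul 2
  filter_upwards [h1.eventually (gt_mem_nhds hε)] with k hk t _
  rw [dist_comm, dist_eq_norm]
  exact (h.norm_sub_le _ _ (hU k) t).trans_lt hk

lemma monotone (h : IsMovementLimit Φ u0 u) : Monotone u := by
  intro s t hst
  obtain ⟨τ, U, hU, hτ⟩ := h.exists_movements
  refine le_of_tendsto_of_tendsto' (h.tendsto hU hτ s) (h.tendsto hU hτ t) fun k => ?_
  have hk := (hU k).pos
  exact (hU k).mono (Nat.floor_mono (by gcongr))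

lemma norm_sub_le_sqrt (h : IsMovementLimit Φ u0 u) {s t : ℝ≥0} (hst : s ≤ t) :
    ‖u t - u s‖ ≤ √(2 * (Φ u0).toReal) * √((t : ℝ) - s) := by
  obtain ⟨τ, U, hU, hτ⟩ := h.exists_movements
  have h1 : Tendsto (fun k => √(2 * (Φ u0).toReal) * √((t : ℝ) - s + τ k)) atTop
      (𝓝 (√(2 * (Φ u0).toReal) * √((t : ℝ) - s + 0))) := ((hτ.const_add _).sqrt).const_mul _
  rw [add_zero] at h1
  exact le_of_tendsto_of_tendsto' ((h.tendsto hU hτ t).sub (h.tendsto hU hτ s)).norm h1 fun k =>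
    (hU k).norm_apply_sub_apply_le s.2 hst

lemma norm_sub_le_sqrt_abs (h : IsMovementLimit Φ u0 u) (s t : ℝ≥0) :
    ‖u s - u t‖ ≤ √(2 * (Φ u0).toReal) * √|(t : ℝ) - s| := by
  rcases le_total s t with hst | hst
  · rw [norm_sub_rev, abs_of_nonneg (sub_nonneg.2 (NNReal.coe_le_coe.2 hst))]
    exact h.norm_sub_le_sqrt hst
  · rw [abs_sub_comm, abs_of_nonneg (sub_nonneg.2 (NNReal.coe_le_coe.2 hst))]
    exact h.norm_sub_le_sqrt hst

lemma continuous (h : IsMovementLimit Φ u0 u) : Continuous u := by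
  rw [continuous_iff_continuousAt]
  intro t
  rw [ContinuousAt, tendsto_iff_norm_sub_tendsto_zero]
  refine squeeze_zero (fun _ => norm_nonneg _) (fun s => h.norm_sub_le_sqrt_abs s t) ?_
  have hc : Continuous fun s : ℝ≥0 => √(2 * (Φ u0).toReal) * √|(t : ℝ) - s| := by fun_prop
  simpa using hc.tendsto t

lemma solvesObstacle_of_tendsto (h : IsMovementLimit Φ u0 u) {τ : ℕ → ℝ}
    {U : ℕ → ℕ → Lp ℝ 1 μ} (hU : ∀ k, IsMovement Φ u0 (τ k) (U k)) (hτ : Tendsto τ atTop (𝓝 0))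
    {t : ℝ≥0} (ht : 0 < t) {l : ℝ}
    (hl : Tendsto (fun k => speed (τ k) (U k) (⌊(t : ℝ) / τ k⌋₊ - 1)) atTop (𝓝 l)) :
    SolvesObstacle Φ u0 l (u t) := by
  refine SolvesObstacle.of_tendsto h.energy h.lt_top ?_ hl (h.tendsto hU hτ t)
  filter_upwards [hτ.eventually (gt_mem_nhds (NNReal.coe_pos.2 ht))] with k hk
  have h1 : 1 ≤ ⌊(t : ℝ) / τ k⌋₊ :=
    Nat.le_floor (by rw [Nat.cast_one]; exact (one_le_div (hU k).pos).2 hk.le)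
  have h2 := (hU k).solvesObstacle (⌊(t : ℝ) / τ k⌋₊ - 1)
  rwa [Nat.sub_add_cancel h1] at h2

/-- The speeds at a fixed time are bounded by dissipation, so a subsequence converges and the
obstacle problem passes to the limit. -/
lemma exists_solvesObstacle (h : IsMovementLimit Φ u0 u) {t : ℝ≥0} (ht : 0 < t) :
    ∃ l, 0 ≤ l ∧ SolvesObstacle Φ u0 l (u t) := by
  obtain ⟨τ, U, hU, hτ⟩ := h.exists_movements
  have ht' : (0 : ℝ) < t := ht
  have hev : ∀ᶠ k in atTop, speed (τ k) (U k) (⌊(t : ℝ) / τ k⌋₊ - 1) ∈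
      Icc 0 √(4 * (Φ u0).toReal / t) := by
    filter_upwards [hτ.eventually (gt_mem_nhds (half_pos ht'))] with k hk
    exact ⟨(hU k).speed_nonneg _, Real.le_sqrt_of_sq_le
      ((hU k).sq_speed_le ht' (by linarith))⟩
  obtain ⟨l, hl, ns, hns, hlim⟩ := isCompact_Icc.tendsto_subseq' hev.frequently
  exact ⟨l, hl.1, h.solvesObstacle_of_tendsto (fun k => hU (ns k)) (hτ.comp hns.tendsto_atTop)
    ht hlim⟩

lemma solvesObstacle (h : IsMovementLimit Φ u0 u) {t : ℝ≥0} (ht : 0 < t) :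
    SolvesObstacle Φ u0 (minMultiplier Φ u0 (u t)) (u t) :=
  solvesObstacle_minMultiplier h.energy h.lt_top (h.exists_solvesObstacle ht)

/-- Multipliers of a given function need not be unique. The canonical choice of the smallest one
makes them agree when the masses, hence the functions, agree; for different masses any choice is
ordered. -/
lemma minMultiplier_anti (h : IsMovementLimit Φ u0 u) {s t : ℝ≥0} (hs : 0 < s) (hst : s ≤ t) :
    minMultiplier Φ u0 (u t) ≤ minMultiplier Φ u0 (u s) := by
  rcases (mass_mono (h.monotone hst)).eq_or_lt with heq | hlt
  · rw [eq_of_le_of_mass_le (h.monotone hst) heq.ge]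
  · exact (h.solvesObstacle hs).multiplier_le (h.solvesObstacle (hs.trans_le hst)) hlt

/-- With multiplier `0`, `u t` would minimize `Φ` above `u0`, hence globally, because replacing `v`
by `v ⊔ u0` does not raise the energy when `u0` is a subsolution. -/
lemma minMultiplier_pos (h : IsMovementLimit Φ u0 u) {t : ℝ≥0} (ht : 0 < t)
    (hv : ∃ v, Φ v < Φ (u t)) : 0 < minMultiplier Φ u0 (u t) := by
  refine (minMultiplier_nonneg _).lt_of_ne fun h0 => ?_
  obtain ⟨v, hv⟩ := hv
  have hv' : Φ v < ⊤ := hv.trans_le le_top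
  have h1 := h.solvesObstacle ht
  rw [← h0] at h1
  have h2 := h1.min (v ⊔ u0) le_sup_right (h.energy.sup_lt_top hv' h.lt_top)
  have h3 := h.energy.toReal_submodular hv' h.lt_top
  have h4 := ENNReal.toReal_mono (h.energy.inf_lt_top hv' h.lt_top).ne
    (h.sub _ (inf_le_right (a := v)))
  have h5 := ENNReal.toReal_strict_mono h1.lt_top.ne hv
  linarith

/-- Every limit point of the speeds is a nonnegative multiplier of `u t`, hence at least the
smallest. If the liminf were too small, the speeds would frequently lie in a compact set strictly
below it. -/
lemma le_liminf_speed (h : IsMovementLimit Φ u0 u) {τ : ℕ → ℝ} {U : ℕ → ℕ → Lp ℝ 1 μ}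
    (hU : ∀ k, IsMovement Φ u0 (τ k) (U k)) (hτ : Tendsto τ atTop (𝓝 0)) {t : ℝ≥0} (ht : 0 < t) :
    ENNReal.ofReal (minMultiplier Φ u0 (u t) ^ 2) ≤
      liminf (fun k => ENNReal.ofReal (speed (τ k) (U k) (⌊(t : ℝ) / τ k⌋₊ - 1) ^ 2)) atTop := by
  by_contra! hlt
  obtain ⟨y, hy1, hy2⟩ := exists_between hlt
  have hfr := frequently_lt_of_liminf_lt (by isBoundedDefault) hy1
  set L := minMultiplier Φ u0 (u t) with hL
  have hL0 : 0 ≤ L := minMultiplier_nonneg _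
  have hfr' : ∃ᶠ k in atTop, speed (τ k) (U k) (⌊(t : ℝ) / τ k⌋₊ - 1) ∈
      {r | 0 ≤ r ∧ ENNReal.ofReal (r ^ 2) ≤ y} := hfr.mono fun k hk =>
    ⟨(hU k).speed_nonneg _, hk.le⟩
  have hcl : IsClosed {r : ℝ | 0 ≤ r ∧ ENNReal.ofReal (r ^ 2) ≤ y} :=
    (isClosed_le continuous_const continuous_id).inter
      (isClosed_le (ENNReal.continuous_ofReal.comp (by fun_prop)) continuous_const)
  have hsub : {r : ℝ | 0 ≤ r ∧ ENNReal.ofReal (r ^ 2) ≤ y} ⊆ Icc 0 L := fun r hr => by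
    refine ⟨hr.1, ?_⟩
    by_contra! hr'
    have : ENNReal.ofReal (L ^ 2) ≤ ENNReal.ofReal (r ^ 2) :=
      ENNReal.ofReal_le_ofReal (by gcongr)
    exact absurd (hr.2.trans_lt hy2) (not_lt.2 this)
  obtain ⟨l, hl, ns, hns, hlim⟩ :=
    (isCompact_Icc.of_isClosed_subset hcl hsub).tendsto_subseq' hfr'
  have h1 := minMultiplier_le hl.1 (h.solvesObstacle_of_tendsto (fun k => hU (ns k))
    (hτ.comp hns.tendsto_atTop) ht hlim)
  have h2 : ENNReal.ofReal (L ^ 2) ≤ ENNReal.ofReal (l ^ 2) := ENNReal.ofReal_le_ofReal (by gcongr)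
  exact absurd (hl.2.trans_lt hy2) (not_lt.2 h2)

lemma antitoneOn (h : IsMovementLimit Φ u0 u) :
    AntitoneOn (fun t : ℝ => minMultiplier Φ u0 (u t.toNNReal)) (Ioi 0) := fun _ hs _ _ hst =>
  h.minMultiplier_anti (Real.toNNReal_pos.2 hs) (Real.toNNReal_le_toNNReal hst)

lemma memLp (h : IsMovementLimit Φ u0 u) :
    MemLp (fun t : ℝ => minMultiplier Φ u0 (u t.toNNReal)) 2 (volume.restrict (Ioi (0 : ℝ))) := by
  have hm : AEStronglyMeasurable (fun t : ℝ => minMultiplier Φ u0 (u t.toNNReal))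
      (volume.restrict (Ioi (0 : ℝ))) :=
    (aemeasurable_restrict_of_antitoneOn measurableSet_Ioi h.antitoneOn).aestronglyMeasurable
  rw [memLp_two_iff_integrable_sq hm]
  refine ⟨hm.pow 2, ?_⟩
  rw [hasFiniteIntegral_iff_ofReal (ae_of_all _ fun _ => sq_nonneg _)]
  obtain ⟨τ, U, hU, hτ⟩ := h.exists_movements
  calc ∫⁻ t in Ioi (0 : ℝ), ENNReal.ofReal (minMultiplier Φ u0 (u t.toNNReal) ^ 2)
      ≤ ∫⁻ t in Ioi (0 : ℝ), liminf (fun k =>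
          ENNReal.ofReal (speed (τ k) (U k) (⌊t / τ k⌋₊ - 1) ^ 2)) atTop := by
        refine setLIntegral_mono' measurableSet_Ioi fun t ht => ?_
        have h1 := h.le_liminf_speed hU hτ (Real.toNNReal_pos.2 ht)
        rwa [Real.coe_toNNReal t (le_of_lt ht)] at h1
    _ ≤ liminf (fun k => ∫⁻ t in Ioi (0 : ℝ),
          ENNReal.ofReal (speed (τ k) (U k) (⌊t / τ k⌋₊ - 1) ^ 2)) atTop := by
        -- Fatou's lemma; the integrals on the right are bounded uniformly in `k` by the action.
        refine lintegral_liminf_le fun k => ?_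
        have h1 : Measurable fun n : ℕ => ENNReal.ofReal (speed (τ k) (U k) (n - 1) ^ 2) :=
          measurable_from_top
        exact h1.comp (Nat.measurable_floor.comp (measurable_id.div_const _))
    _ ≤ ENNReal.ofReal (2 * √(2 * (Φ u0).toReal) ^ 2) :=
        liminf_le_of_le (by isBoundedDefault) fun b hb => by
          obtain ⟨k, hk⟩ := hb.exists
          exact hk.trans (hU k).eulerScheme.lintegral_sq_le
    _ < ⊤ := ENNReal.ofReal_lt_top

end IsMovementLimit

end Limit

/-! ### Return to the Dirichlet problem. -/

section Dirichlet

variable {d : ℕ} {Ω : Set (E d)} {F : E d → ℝ≥0∞} {u0 : L1 Ω}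

lemma IsSubsolution.isEnergySub (h : IsSubsolution F Ω u0) :
    IsEnergySub (dirichletEnergy F Ω u0) u0 := fun v hv =>
  le_iInf fun hw => dirichletEnergy_self.trans_le (h v hw hv)

lemma isObstacleSolution_iff (hfin : energy F Ω u0 < ⊤) {l : ℝ} {v : L1 Ω} :
    IsObstacleSolution F Ω u0 l v ↔ SolvesObstacle (dirichletEnergy F Ω u0) u0 l v := by
  have hcoe : ∀ w : L1 Ω, dirichletEnergy F Ω u0 w < ⊤ →
      (dirichletEnergy F Ω u0 w : EReal) + ((l * ∫ x in Ω, w x : ℝ) : EReal) =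
        (((dirichletEnergy F Ω u0 w).toReal + l * mass w : ℝ) : EReal) := by
    intro w hw
    rw [EReal.coe_add, ← EReal.toReal_coe_ennreal, EReal.coe_toReal (by simpa using hw.ne)
      (EReal.coe_ennreal_ne_bot _), mass]
  constructor
  · rintro ⟨hle, hmin⟩
    have hself : dirichletEnergy F Ω u0 u0 < ⊤ := dirichletEnergy_self.trans_lt hfin
    -- Comparison with `u0` itself excludes a minimizer of infinite energy.
    have hv : dirichletEnergy F Ω u0 v < ⊤ := by
      refine lt_top_iff_ne_top.2 fun htop => ?_
      have h := isMinOn_iff.1 hmin u0 (le_refl u0)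
      simp only [hcoe u0 hself, htop] at h
      rw [EReal.coe_ennreal_top, EReal.top_add_coe] at h
      exact absurd h (not_le.2 (EReal.coe_lt_top _))
    refine ⟨hle, hv, fun w hw hwfin => ?_⟩
    have h := isMinOn_iff.1 hmin w hw
    simp only [hcoe w hwfin, hcoe v hv] at h
    exact EReal.coe_le_coe_iff.1 h
  · rintro ⟨hle, hv, hmin⟩
    refine ⟨hle, isMinOn_iff.2 fun w hw => ?_⟩
    rcases (le_top (a := dirichletEnergy F Ω u0 w)).eq_or_lt with hwtop | hwfin
    · rw [hwtop, EReal.coe_ennreal_top, EReal.top_add_coe]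
      exact le_top
    · rw [hcoe w hwfin, hcoe v hv]
      exact EReal.coe_le_coe_iff.2 (hmin w hw hwfin)

lemma IsMinimizingMovement.isMovement (hΦ : IsLatticeEnergy (dirichletEnergy F Ω u0))
    (hsub : IsSubsolution F Ω u0) (hfin : energy F Ω u0 < ⊤) {τ : ℝ} (hτ : 0 < τ) {U : ℕ → L1 Ω}
    (h : IsMinimizingMovement F Ω u0 τ U) : IsMovement (dirichletEnergy F Ω u0) u0 τ U :=
  ⟨hΦ, hsub.isEnergySub, dirichletEnergy_self.trans_lt hfin, hτ, h.1, h.2⟩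

end Dirichlet

theorem mainTheorem4 {d : ℕ} (hd : 0 < d) (Ω : Set (E d)) (hΩo : IsOpen Ω)
    (hΩb : Bornology.IsBounded Ω) (hΩc : IsConnected Ω)
    (F : E d → ℝ≥0∞) (hF0 : F 0 = 0) (hFlsc : LowerSemicontinuous F)
    (hFconv : StrictlyConvex F) (hFsup : Superlinear F)
    (u0 : L1 Ω) (hsub : IsSubsolution F Ω u0) (hfin : energy F Ω u0 < ⊤) :
    ∃ u : ℝ≥0 → L1 Ω,
      IsLimitSolution F Ω u0 u ∧
      (∀ w : ℝ≥0 → L1 Ω, IsLimitSolution F Ω u0 w → w = u) ∧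
      (∀ s t : ℝ≥0, ‖u s - u t‖ ≤
        √(2 * (energy F Ω u0).toReal) * √|(t : ℝ) - (s : ℝ)|) ∧
      Monotone u ∧
      ∃ l : ℝ → ℝ,
        MemLp l 2 (volume.restrict (Ioi (0 : ℝ))) ∧
        AntitoneOn l (Ioi (0 : ℝ)) ∧
        (∀ t : ℝ, 0 < t → 0 ≤ l t) ∧
        (∀ t : ℝ≥0, 0 < t →
          (∃ v : L1 Ω, dirichletEnergy F Ω u0 v < dirichletEnergy F Ω u0 (u t)) →
            0 < l (t : ℝ)) ∧
        (∀ᵐ t : ℝ ∂(volume.restrict (Ioi (0 : ℝ))),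
          IsObstacleSolution F Ω u0 (l t) (u t.toNNReal) ∧
          ∀ v : L1 Ω, IsObstacleSolution F Ω u0 (l t) v → v = u t.toNNReal) := by
  have hΦ : IsLatticeEnergy (dirichletEnergy F Ω u0) :=
    isLatticeEnergy_dirichletEnergy hd hΩo hΩb hFlsc hFconv hFsup hfin
  have hself : dirichletEnergy F Ω u0 u0 = energy F Ω u0 := dirichletEnergy_self
  have hfin' : dirichletEnergy F Ω u0 u0 < ⊤ := hself.trans_lt hfin
  obtain ⟨u, hu⟩ := exists_limit hΦ hsub.isEnergySub hfin'
  have h : IsMovementLimit (dirichletEnergy F Ω u0) u0 u := ⟨hΦ, hsub.isEnergySub, hfin', hu⟩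
  refine ⟨u, ⟨h.continuous, ?_⟩, ?_, ?_, h.monotone,
    fun t => minMultiplier (dirichletEnergy F Ω u0) u0 (u t.toNNReal), h.memLp, h.antitoneOn,
    fun t _ => minMultiplier_nonneg _, fun t ht hv => ?_, ?_⟩
  · obtain ⟨τ, U, hU, hτ⟩ := h.exists_movements
    exact ⟨τ, U, fun k => (hU k).pos, hτ, fun k => ⟨(hU k).zero, (hU k).step⟩,
      fun T => h.tendstoUniformlyOn hU hτ _⟩
  · rintro w ⟨-, τ, U, hpos, hτ, hU, hlim⟩
    ext1 t
    -- The movements behind any limit solution converge to `u` at each time, whatever the steps and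
    -- the minimizers chosen.
    exact tendsto_nhds_unique ((hlim t).tendsto_at ⟨zero_le, le_rfl⟩)
      (h.tendsto (fun k => (hU k).isMovement hΦ hsub hfin (hpos k)) hτ t)
  · intro s t
    rw [← hself]
    exact h.norm_sub_le_sqrt_abs s t
  · simp only [Real.toNNReal_coe]
    exact h.minMultiplier_pos ht hv
  -- The obstacle characterization holds at every `t > 0`, not only almost everywhere.
  · refine (ae_restrict_iff' measurableSet_Ioi).2 (ae_of_all _ fun t ht => ?_)
    have h1 := h.solvesObstacle (Real.toNNReal_pos.2 ht)
    refine ⟨(isObstacleSolution_iff hfin).2 h1, fun v hv => ?_⟩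
    exact ((isObstacleSolution_iff hfin).1 hv).unique hΦ h1
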